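/- Let $n\ge 0$ be an integer, let $F_n$ be the free group of rank $n$, and let $\overline{\mathrm{IA}}_n$ (the Torelli subgroup) be the kernel of the homomorphism $\mathrm{Out}(F_n)\to \mathrm{GL}(n,\mathbb Z)$ given by the action of $\mathrm{Out}(F_n)$ on the first homology of $F_n$. Then every non-trivial subgroup of $\overline{\mathrm{IA}}_n$ maps onto $\mathbb Z$, that is, it admits a surjective homomorphism to $\mathbb Z$. Moreover, let $\gamma_1=F_n$ and $\gamma_{c+1}=[\gamma_c,F_n]$ for $c\ge 1$ be the lower central series of $F_n$, let $G_c$ be the kernel of the natural map $\mathrm{Aut}(F_n)\to\mathrm{Aut}(F_n/\gamma_{c+1})$, and let $H_c$ be the image of $G_c$ in $\mathrm{Out}(F_n)$. Then $H_1=\overline{\mathrm{IA}}_n$, $H_{c+1}\le H_c$ for all $c\ge1$, $\bigcap_{c\ge 1}H_c=1$, and for every $c\ge 1$ the quotient $H_c/H_{c+1}$ is a finitely generated free abelian group. -/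

import Mathlib

namespace FreeGroupOut

/-- The inner automorphisms form a normal subgroup of the automorphism group. -/
instance inn_normal (G : Type*) [Group G] : (MulAut.conj (G := G)).range.Normal := by
  constructor
  rintro _ ⟨g, rfl⟩ φ
  refine ⟨φ g, ?_⟩
  ext x
  simp [MulAut.conj_apply]

/-- The outer automorphism group `Out(G) = Aut(G) / Inn(G)`. -/
abbrev Out (G : Type*) [Group G] : Type _ := MulAut G ⧸ (MulAut.conj (G := G)).range

/-- The first homology group of a group: its abelianization, written additively. -/
abbrev H1 (G : Type*) [Group G] : Type _ := Additive (Abelianization G)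

/-- The action of `Aut(G)` on the first homology of `G`: the automorphism `φ` sends the class
of `x` to the class of `φ x`. -/
def autToGLH1 (G : Type*) [Group G] : MulAut G →* LinearMap.GeneralLinearGroup ℤ (H1 G) where
  toFun φ := LinearMap.GeneralLinearGroup.ofLinearEquiv
    (MulEquiv.toAdditive φ.abelianizationCongr).toIntLinearEquiv
  map_one' := by
    ext x
    obtain ⟨y, hy⟩ := QuotientGroup.mk_surjective x.toMul
    obtain rfl : x = Additive.ofMul (Abelianization.of y) := congrArg Additive.ofMul hy.symm
    rfl
  map_mul' φ ψ := by
    ext x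
    obtain ⟨y, hy⟩ := QuotientGroup.mk_surjective x.toMul
    obtain rfl : x = Additive.ofMul (Abelianization.of y) := congrArg Additive.ofMul hy.symm
    rfl

theorem autToGLH1_apply {G : Type*} [Group G] (φ : MulAut G) (x : G) :
    (autToGLH1 G φ : H1 G →ₗ[ℤ] H1 G) (Additive.ofMul (Abelianization.of x)) =
      Additive.ofMul (Abelianization.of (φ x)) :=
  rfl

/-- The basis of `H₁(F_n)` given by the classes of the free generators. -/
noncomputable def basisH1 (n : ℕ) : Module.Basis (Fin n) ℤ (H1 (FreeGroup (Fin n))) :=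
  FreeAbelianGroup.basis (Fin n)

/-- The map `Aut(F_n) → GL(n, ℤ)` given by the action on the first homology of `F_n`. -/
noncomputable def autToGL (n : ℕ) : MulAut (FreeGroup (Fin n)) →* GL (Fin n) ℤ :=
  (Matrix.GeneralLinearGroup.toLin' (basisH1 n)).symm.toMonoidHom.comp
    (autToGLH1 (FreeGroup (Fin n)))

theorem inn_le_ker_autToGL (n : ℕ) :
    (MulAut.conj (G := FreeGroup (Fin n))).range ≤ (autToGL n).ker := by
  rintro _ ⟨g, rfl⟩
  have h : autToGLH1 (FreeGroup (Fin n)) (MulAut.conj g) = 1 := by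
    ext x
    obtain ⟨y, hy⟩ := QuotientGroup.mk_surjective x.toMul
    obtain rfl : x = Additive.ofMul (Abelianization.of y) := congrArg Additive.ofMul hy.symm
    rw [autToGLH1_apply]
    simp [MulAut.conj_apply]
  simp [MonoidHom.mem_ker, autToGL, h]

/-- The map `Out(F_n) → GL(n, ℤ)` given by the action on the first homology of `F_n`. -/
noncomputable def outToGL (n : ℕ) : Out (FreeGroup (Fin n)) →* GL (Fin n) ℤ :=
  QuotientGroup.lift _ (autToGL n) (inn_le_ker_autToGL n)

/-- The Torelli subgroup of `Out(F_n)`, the kernel of `Out(F_n) → GL(n, ℤ)`. -/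
noncomputable def torelli (n : ℕ) : Subgroup (Out (FreeGroup (Fin n))) :=
  (outToGL n).ker

/-- The natural map `Aut(G) → Aut(G / N)` for a characteristic subgroup `N`. -/
def autQuotient {G : Type*} [Group G] (N : Subgroup G) [hN : N.Characteristic] :
    MulAut G →* MulAut (G ⧸ N) where
  toFun φ := QuotientGroup.congr N N φ (Subgroup.characteristic_iff_map_eq.mp hN φ)
  map_one' := by
    ext x
    obtain ⟨y, rfl⟩ := QuotientGroup.mk_surjective x
    rfl
  map_mul' φ ψ := by
    ext x
    obtain ⟨y, rfl⟩ := QuotientGroup.mk_surjective x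
    rfl

/-- The lower central series, indexed from `1`: `gamma G 1 = G` and
`gamma G (c + 1) = [gamma G c, G]` for `c ≥ 1`. -/
def gamma (G : Type*) [Group G] (c : ℕ) : Subgroup G :=
  (⊤ : Subgroup G).lowerCentralSeries (c - 1)

instance gamma_characteristic (G : Type*) [Group G] (c : ℕ) : (gamma G c).Characteristic :=
  Subgroup.lowerCentralSeries_characteristic _ _

theorem gamma_one (G : Type*) [Group G] : gamma G 1 = ⊤ := rfl

theorem gamma_succ (G : Type*) [Group G] (c : ℕ) (hc : 1 ≤ c) :
    gamma G (c + 1) = ⁅gamma G c, (⊤ : Subgroup G)⁆ := by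
  obtain ⟨d, rfl⟩ := Nat.exists_eq_add_of_le' hc
  rfl

/-- The Andreadakis filtration of `Aut(F_n)`: the term `G_c` is the kernel of the natural map
`Aut(F_n) → Aut(F_n / γ_{c+1})`. -/
def andreadakis (n c : ℕ) : Subgroup (MulAut (FreeGroup (Fin n))) :=
  (autQuotient (gamma (FreeGroup (Fin n)) (c + 1))).ker

/-- The image `H_c` of `G_c` under the projection `Aut(F_n) → Out(F_n)`. -/
def outAndreadakis (n c : ℕ) : Subgroup (Out (FreeGroup (Fin n))) :=
  (andreadakis n c).map (QuotientGroup.mk' _)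

instance outAndreadakis_normal (n c : ℕ) : (outAndreadakis n c).Normal :=
  Subgroup.Normal.map (MonoidHom.normal_ker _) _ (QuotientGroup.mk'_surjective _)

end FreeGroupOut

/-! The Johnson homomorphism sends `φ ∈ G_c` to the classes of `φ(x_i) x_i⁻¹` in `γ_{c+1}/γ_{c+2}`;
its kernel is `G_{c+1}`. Dividing the target by the image of the inner automorphisms gives an
embedding of `H_c/H_{c+1}` (`mem_ker_outerJohnson_iff`), so this quotient is free abelian of finite
rank once the inner image is pure.

Purity is read off the Magnus expansion. Its leading term embeds `γ_k/γ_{k+1}` in the noncommutative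
polynomials, and the image is pure because Lyndon commutators span the source (`span_lyndonClass`)
and have distinct leading words with coefficient 1 (`leadsWith_magnusCoeff`). Conjugation by `g`
with leading term `P` becomes the family `P X_i - X_i P`; for `n ≥ 2`, an integer dividing the whole
family divides `P` (`dvd_coeff_of_dvd_commutator`), hence `mem_innerJohnson_of_smul_mem`. For `n ≤
1` the Torelli group is trivial.

For separation, let `φ` represent a class in every `H_c`. Then `φ(x_i)` is conjugate to `x_i` modulo
every `γ_c`. The trace of a representation by `2 × 2` matrices over `ℤ[X]`, congruent to 1 modulo
`X`, turns this into a genuine conjugacy (`exists_eq_conj_of`), so `φ` may be assumed to fix `x_i`.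
The remaining inner corrections are powers of `x_i` (`exists_zpow_mul_mem_gamma`), with an exponent
that stabilizes, and residual nilpotence makes `φ` inner.

A non-trivial subgroup of the Torelli group therefore lies in some `H_c` but not in `H_{c+1}`; it
has non-trivial image in `H_c/H_{c+1} ≅ ℤ^r`, and some coordinate is non-zero on it. -/

namespace FreeGroupOut

open scoped commutatorElement

/-! ### Commutator calculus along the lower central series. -/

section LowerCentralSeries

variable {G : Type*} [Group G]

theorem gamma_antitone : Antitone (gamma G) := fun _ _ h =>
  Subgroup.lowerCentralSeries_antitone _ (Nat.sub_le_sub_right h 1)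

/-- The three subgroups lemma, applied in the quotient by `N`. -/
theorem commutator_commutator_le_of_rotate {H₁ H₂ H₃ N : Subgroup G} [N.Normal]
    (h1 : ⁅⁅H₂, H₃⁆, H₁⁆ ≤ N) (h2 : ⁅⁅H₃, H₁⁆, H₂⁆ ≤ N) : ⁅⁅H₁, H₂⁆, H₃⁆ ≤ N := by
  have key : ∀ K : Subgroup G, K ≤ N ↔ K.map (QuotientGroup.mk' N) = ⊥ := by
    intro K
    rw [Subgroup.map_eq_bot_iff, QuotientGroup.ker_mk']
  rw [key] at *
  simp only [Subgroup.map_commutator] at *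
  exact Subgroup.commutator_commutator_eq_bot_of_rotate h1 h2

theorem commutator_gamma_le_succ (i j : ℕ) :
    ⁅gamma G (i + 1), gamma G (j + 1)⁆ ≤ gamma G (i + 1 + (j + 1)) := by
  induction j generalizing i with
  | zero => exact (gamma_succ G (i + 1) (by omega)).ge
  | succ j ih =>
    rw [gamma_succ G (j + 1) (by omega), Subgroup.commutator_comm]
    refine commutator_commutator_le_of_rotate ?_ ?_
    · rw [Subgroup.commutator_comm ⊤, ← gamma_succ G (i + 1) (by omega)]
      exact (ih (i + 1)).trans (gamma_antitone (by omega))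
    · refine (Subgroup.commutator_mono (ih i) le_rfl).trans ?_
      rw [← gamma_succ G _ (by omega)]
      exact gamma_antitone (by omega)

theorem commutator_gamma_le (i j : ℕ) : ⁅gamma G i, gamma G j⁆ ≤ gamma G (i + j) := by
  -- Truncated subtraction makes `gamma G 0` the whole group, so an index 0 only requires normality.
  rcases i with _ | i
  · rw [zero_add]
    exact Subgroup.commutator_le_right _ _
  rcases j with _ | j
  · exact Subgroup.commutator_le_left _ _
  exact commutator_gamma_le_succ i j

theorem commutator_mem_gamma {i j : ℕ} {x y : G} (hx : x ∈ gamma G i) (hy : y ∈ gamma G j) :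
    ⁅x, y⁆ ∈ gamma G (i + j) :=
  commutator_gamma_le i j (Subgroup.commutator_mem_commutator hx hy)

theorem mem_gamma_one (x : G) : x ∈ gamma G 1 := by
  rw [gamma_one]; trivial

/-- `γ_N` is central modulo `γ_{N+1}`; this replaces normality of `S`, which is not assumed. -/
theorem conj_mem_iff_of_gamma_le {N : ℕ} {S : Subgroup G} (hS : gamma G (N + 1) ≤ S) {g : G}
    (hg : g ∈ gamma G N) (x : G) : x * g * x⁻¹ ∈ S ↔ g ∈ S := by
  have h : x * g * x⁻¹ = ⁅x, g⁆ * g := by simp [commutatorElement_def]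
  have h' : ⁅x, g⁆ ∈ S :=
    hS (gamma_antitone (by omega) (commutator_mem_gamma (mem_gamma_one x) hg))
  rw [h, Subgroup.mul_mem_cancel_left _ h']

/-- For `y ∈ γ_q`, the elements `x` of `γ_p` with `⁅x, y⁆ ∈ S` form a subgroup, provided that `S`
contains `γ_{p+q+1}`. -/
def commutatorMemSubgroup {p q : ℕ} {S : Subgroup G} (hS : gamma G (p + q + 1) ≤ S) {y : G}
    (hy : y ∈ gamma G q) : Subgroup G where
  carrier := {x | x ∈ gamma G p ∧ ⁅x, y⁆ ∈ S}
  mul_mem' := by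
    rintro a b ⟨ha, ha'⟩ ⟨hb, hb'⟩
    refine ⟨mul_mem ha hb, ?_⟩
    rw [commutatorElement_mul_left_eq_conj_mul]
    exact mul_mem ((conj_mem_iff_of_gamma_le hS (commutator_mem_gamma hb hy) a).2 hb') ha'
  one_mem' := ⟨one_mem _, by simp⟩
  inv_mem' := by
    rintro a ⟨ha, ha'⟩
    refine ⟨inv_mem ha, ?_⟩
    have h := (conj_mem_iff_of_gamma_le hS (inv_mem (commutator_mem_gamma ha hy)) a⁻¹).2
      (inv_mem ha')
    simpa [commutatorElement_inv_left] using h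

theorem gamma_le_commutatorMemSubgroup {p q : ℕ} {S : Subgroup G}
    (hS : gamma G (p + q + 1) ≤ S) {y : G} (hy : y ∈ gamma G q) :
    gamma G (p + 1) ≤ commutatorMemSubgroup hS hy := fun _ hx =>
  ⟨gamma_antitone (by omega) hx, hS (gamma_antitone (by omega) (commutator_mem_gamma hx hy))⟩

theorem commutator_mem_swap {S : Subgroup G} {x y : G} (h : ⁅x, y⁆ ∈ S) : ⁅y, x⁆ ∈ S := by
  rw [← commutatorElement_inv]
  exact inv_mem h

theorem commutator_commutator_swap_mem {i j k : ℕ} {S : Subgroup G}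
    (hS : gamma G (i + j + k + 1) ≤ S) {x y z : G} (hx : x ∈ gamma G i) (hy : y ∈ gamma G j)
    (hz : z ∈ gamma G k) (h : ⁅⁅x, y⁆, z⁆ ∈ S) : ⁅⁅y, x⁆, z⁆ ∈ S := by
  have h1 : ⁅x, y⁆ ∈ commutatorMemSubgroup hS hz := ⟨commutator_mem_gamma hx hy, h⟩
  have h2 := inv_mem h1
  rw [commutatorElement_inv] at h2
  exact h2.2

theorem commutator_inv_commutator_mem {i j k : ℕ} {S : Subgroup G}
    (hS : gamma G (i + j + k + 1) ≤ S) {x y z : G} (hx : x ∈ gamma G i) (hy : y ∈ gamma G j)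
    (hz : z ∈ gamma G k) (h : ⁅⁅x, y⁆, z⁆ ∈ S) : ⁅⁅x⁻¹, y⁆, z⁆ ∈ S := by
  have hxy := commutator_mem_gamma hx hy
  have h1 : ⁅x, y⁆ ∈ commutatorMemSubgroup hS hz := ⟨hxy, h⟩
  have h2 := (conj_mem_iff_of_gamma_le (gamma_le_commutatorMemSubgroup hS hz) (inv_mem hxy) x⁻¹).2
    (inv_mem h1)
  rw [commutatorElement_inv, inv_inv, ← commutatorElement_inv_left] at h2
  exact h2.2

/-- The Jacobi identity for commutators, modulo a subgroup containing the next term of the lower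
central series. -/
theorem commutator_jacobi_mem {i j k : ℕ} {S : Subgroup G}
    (hS : gamma G (i + j + k + 1) ≤ S) {a b v : G} (ha : a ∈ gamma G i) (hb : b ∈ gamma G j)
    (hv : v ∈ gamma G k) (h1 : ⁅⁅a, v⁆, b⁆ ∈ S) (h2 : ⁅⁅b, v⁆, a⁆ ∈ S) : ⁅⁅a, b⁆, v⁆ ∈ S := by
  have hS' : gamma G (i + k + j + 1) ≤ S := le_trans (gamma_antitone (by omega)) hS
  have hS'' : gamma G (k + i + j + 1) ≤ S := le_trans (gamma_antitone (by omega)) hS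
  have hS''' : gamma G (j + k + i + 1) ≤ S := le_trans (gamma_antitone (by omega)) hS
  have ht1 : ⁅⁅v⁻¹, a⁆, b⁆ ∈ S := commutator_inv_commutator_mem hS'' hv ha hb
    (commutator_commutator_swap_mem hS' ha hv hb h1)
  have ht2 : ⁅⁅b⁻¹, v⁆, a⁆ ∈ S := commutator_inv_commutator_mem hS''' hb hv ha h2
  have e1 := (conj_mem_iff_of_gamma_le hS''
    (commutator_mem_gamma (commutator_mem_gamma (inv_mem hv) ha) hb) v).2 ht1
  have e2 := (conj_mem_iff_of_gamma_le hS'''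
    (commutator_mem_gamma (commutator_mem_gamma (inv_mem hb) hv) ha) b).2 ht2
  -- The Hall–Witt identity: two of its three factors lie in `S`, hence so does the third. The
  -- conjugations and inverses in it are harmless modulo `S`.
  have hw := conj_commutatorElement_left_commutatorElement_mul a b v
  have hw' : a * ⁅⁅a⁻¹, b⁆, v⁆ * a⁻¹ =
      ((v * ⁅⁅v⁻¹, a⁆, b⁆ * v⁻¹) * (b * ⁅⁅b⁻¹, v⁆, a⁆ * b⁻¹))⁻¹ := by
    rw [eq_inv_iff_mul_eq_one, ← hw]
    simp only [mul_assoc]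
  have e3 : a * ⁅⁅a⁻¹, b⁆, v⁆ * a⁻¹ ∈ S := hw' ▸ inv_mem (mul_mem e1 e2)
  have e4 := (conj_mem_iff_of_gamma_le hS
    (commutator_mem_gamma (commutator_mem_gamma (inv_mem ha) hb) hv) a).1 e3
  simpa using commutator_inv_commutator_mem hS (inv_mem ha) hb hv e4

end LowerCentralSeries

/-! ### Lyndon words and their standard bracketings. -/

section Lyndon

/-- The word read off the leaves of a tree. -/
def leafWord {α : Type*} : FreeMagma α → List α
  | .of a => [a]
  | .mul s t => leafWord s ++ leafWord t

theorem leafWord_ne_nil {α : Type*} (t : FreeMagma α) : leafWord t ≠ [] := by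
  induction t using FreeMagma.recOnMul with
  | ih1 a => exact List.cons_ne_nil _ _
  | ih2 s t hs ht => exact fun h => hs (List.append_eq_nil_iff.1 h).1

variable {α : Type*} [LinearOrder α]

theorem append_lt_append_left_iff (u s t : List α) : u ++ s < u ++ t ↔ s < t := by
  induction u with
  | nil => rfl
  | cons a u ih => simp [List.cons_append, ih]

theorem lt_append_of_ne_nil (u : List α) {v : List α} (hv : v ≠ []) : u < u ++ v := by
  have h : u ++ [] < u ++ v := (append_lt_append_left_iff u [] v).2 (by
    cases v with
    | nil => exact absurd rfl hv
    | cons a v => exact List.nil_lt_cons a v)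
  simpa using h

theorem append_lt_append_of_lt_of_not_prefix {u v : List α} (h : u < v) (hp : ¬ u <+: v)
    (s t : List α) : u ++ s < v ++ t := by
  induction u generalizing v with
  | nil => exact absurd List.nil_prefix hp
  | cons a u ih =>
    cases v with
    | nil => simp at h
    | cons b v =>
      rw [List.cons_append, List.cons_append, List.cons_lt_cons_iff]
      rw [List.cons_lt_cons_iff] at h
      rcases h with h | ⟨rfl, h⟩
      · exact Or.inl h
      · exact Or.inr ⟨rfl, ih h (by simpa using hp)⟩

/-- A Lyndon word: a non-empty word smaller than all its proper suffixes. -/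
def IsLyndonWord (w : List α) : Prop :=
  w ≠ [] ∧ ∀ u v, u ≠ [] → v ≠ [] → w = u ++ v → w < v

/-- If `v = u ++ s`, compare `v` with its suffix `s` after cancelling `u`; otherwise the first
differing letter decides. -/
theorem IsLyndonWord.append_lt {u v : List α} (hu : u ≠ []) (hv : IsLyndonWord v) (h : u < v) :
    u ++ v < v := by
  by_cases hp : u <+: v
  · obtain ⟨s, rfl⟩ := hp
    have hs : s ≠ [] := by
      rintro rfl
      simp at h
    exact (append_lt_append_left_iff u _ _).2 (hv.2 u s hu hs rfl)
  · simpa using append_lt_append_of_lt_of_not_prefix h hp v []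

theorem IsLyndonWord.append {u v : List α} (hu : IsLyndonWord u) (hv : IsLyndonWord v)
    (h : u < v) : IsLyndonWord (u ++ v) := by
  have huv := hv.append_lt hu.1 h
  refine ⟨by simp [hu.1], fun x y hx hy he => ?_⟩
  rcases List.append_eq_append_iff.1 he with ⟨z, rfl, rfl⟩ | ⟨z, rfl, rfl⟩
  · rcases eq_or_ne z [] with rfl | hz
    · simpa using huv
    · exact huv.trans (hv.2 z y hz hy rfl)
  · rcases eq_or_ne z [] with rfl | hz
    · simpa using huv
    · have h1 := hu.2 x z hx hz rfl
      -- The suffix `z` is shorter than `x ++ z`, so the strict inequality comes from a letter and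
      -- survives appending `v`.
      refine append_lt_append_of_lt_of_not_prefix h1 (fun hp => ?_) v v
      have h2 := hp.length_le
      have h3 := List.length_pos_iff.2 hx
      rw [List.length_append] at h2
      omega

/-- The condition on the left factor of a standard bracketing: it is a letter or its right factor
is at least `w`. -/
def RightFactorGE (w : List α) : FreeMagma α → Prop
  | .of _ => True
  | .mul _ t => w ≤ leafWord t

/-- The trees that are standard bracketings of Lyndon words. -/
def IsLyndonTree : FreeMagma α → Prop
  | .of _ => True
  | .mul s t => IsLyndonTree s ∧ IsLyndonTree t ∧ leafWord s < leafWord t ∧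
      RightFactorGE (leafWord t) s

theorem IsLyndonTree.isLyndonWord {t : FreeMagma α} (h : IsLyndonTree t) :
    IsLyndonWord (leafWord t) := by
  induction t using FreeMagma.recOnMul with
  | ih1 a =>
    refine ⟨List.cons_ne_nil _ _, fun u v hu hv he => ?_⟩
    have := congrArg List.length he
    have := List.length_pos_iff.2 hu
    have := List.length_pos_iff.2 hv
    simp [leafWord] at *
    omega
  | ih2 s t hs ht =>
    obtain ⟨h1, h2, h3, -⟩ := h
    exact (hs h1).append (ht h2) h3

/-- The right factor is the smallest proper suffix. A longer suffix is `x ++ leafWord t` with `x` a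
suffix of the left factor; if `x` is proper, induction bounds it below by the right factor of `s`,
and standardness bounds that below by `leafWord t`. -/
theorem leafWord_right_le_suffix {s t : FreeMagma α} (h : IsLyndonTree (.mul s t))
    {y z : List α} (hy : y ≠ []) (hz : z ≠ []) (he : leafWord s ++ leafWord t = y ++ z) :
    leafWord t ≤ z := by
  induction s using FreeMagma.recOnMul generalizing t y z with
  | ih1 a =>
    cases y with
    | nil => exact absurd rfl hy
    | cons b y =>
      obtain ⟨-, he⟩ := List.cons.inj (show a :: leafWord t = b :: (y ++ z) from he)
      rcases eq_or_ne y [] with rfl | hy'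
      · exact he.le
      · exact (h.2.1.isLyndonWord.2 y z hy' hz he).le
  | ih2 s₁ s₂ ih₁ ih₂ =>
    obtain ⟨h1, h2, h3, h4⟩ := h
    rcases List.append_eq_append_iff.1 he with ⟨x, rfl, hx⟩ | ⟨x, hx, rfl⟩
    · rcases eq_or_ne x [] with rfl | hx'
      · exact hx.le
      · exact (h2.isLyndonWord.2 x z hx' hz hx).le
    · rcases eq_or_ne x [] with rfl | hx'
      · simp
      · refine le_trans ?_ (lt_append_of_ne_nil x (leafWord_ne_nil t)).le
        exact le_trans h4 (ih₁ h1 hy hx' hx)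

/-- The cut is forced by the word. If two cuts differ by an overlap `z`, then `z` precedes `leafWord
s₂` because `z ++ leafWord s₂` is Lyndon, yet `z` is a proper suffix of the left factor `s₁`, so
standardness puts it at or above `leafWord s₂`. -/
theorem leafWord_injOn {s t : FreeMagma α} (hs : IsLyndonTree s) (ht : IsLyndonTree t)
    (h : leafWord s = leafWord t) : s = t := by
  have aux : ∀ {s₁ s₂ t₁ t₂ : FreeMagma α} {z : List α}, IsLyndonTree (.mul s₁ s₂) →
      IsLyndonTree (.mul t₁ t₂) → leafWord s₁ = leafWord t₁ ++ z →
      leafWord t₂ = z ++ leafWord s₂ → z = [] := by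
    intro s₁ s₂ t₁ t₂ z hs ht h1 h2
    by_contra hz
    have hlt : z ++ leafWord s₂ < leafWord s₂ := by
      have := ht.2.1.isLyndonWord.2 z (leafWord s₂) hz (leafWord_ne_nil _) h2
      rwa [h2] at this
    have hz' : z < leafWord s₂ := (lt_append_of_ne_nil z (leafWord_ne_nil s₂)).trans hlt
    cases s₁ with
    | of a =>
      have := congrArg List.length h1
      have := List.length_pos_iff.2 hz
      have := List.length_pos_iff.2 (leafWord_ne_nil t₁)
      simp [leafWord] at *
      omega
    | mul a b =>
      have h3 := leafWord_right_le_suffix hs.1 (leafWord_ne_nil t₁) hz h1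
      exact absurd (lt_of_le_of_lt h3 hz') (not_lt.2 hs.2.2.2)
  induction s using FreeMagma.recOnMul generalizing t with
  | ih1 a =>
    cases t with
    | of b => rw [(List.cons.inj h).1]
    | mul t₁ t₂ =>
      have := congrArg List.length h
      have := List.length_pos_iff.2 (leafWord_ne_nil t₁)
      have := List.length_pos_iff.2 (leafWord_ne_nil t₂)
      simp [leafWord] at *
      omega
  | ih2 s₁ s₂ ih₁ ih₂ =>
    cases t with
    | of b =>
      have := congrArg List.length h
      have := List.length_pos_iff.2 (leafWord_ne_nil s₁)
      have := List.length_pos_iff.2 (leafWord_ne_nil s₂)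
      simp [leafWord] at *
      omega
    | mul t₁ t₂ =>
      have h12 : leafWord s₁ = leafWord t₁ ∧ leafWord s₂ = leafWord t₂ := by
        rcases List.append_eq_append_iff.1 h with ⟨z, h1, h2⟩ | ⟨z, h1, h2⟩
        · obtain rfl := aux ht hs h1 h2
          simp_all
        · obtain rfl := aux hs ht h1 h2
          simp_all
      rw [ih₁ hs.1 ht.1 h12.1, ih₂ hs.2.1 ht.2.1 h12.2]
      rfl

end Lyndon

/-! ### Lyndon commutators generate the successive quotients of the lower central series. -/

section LyndonSpan

variable {G : Type*} [Group G] {α : Type*}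

/-- The iterated commutator of group elements described by a tree. -/
def treeCommutator (x : α → G) : FreeMagma α → G
  | .of a => x a
  | .mul s t => ⁅treeCommutator x s, treeCommutator x t⁆

theorem treeCommutator_mem_gamma (x : α → G) (t : FreeMagma α) :
    treeCommutator x t ∈ gamma G (leafWord t).length := by
  induction t using FreeMagma.recOnMul with
  | ih1 a => exact mem_gamma_one _
  | ih2 s t hs ht =>
    rw [show leafWord (s * t) = leafWord s ++ leafWord t from rfl, List.length_append]
    exact commutator_mem_gamma hs ht

variable [LinearOrder α]

/-- The tree is a letter or its right factor is at most `w`. -/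
def RightFactorLE (w : List α) : FreeMagma α → Prop
  | .of _ => True
  | .mul _ t => leafWord t ≤ w

/-- The subgroup generated by `γ_{N+1}` and by the commutators of the Lyndon trees with `N` leaves
satisfying `P`. -/
def lyndonSpan (x : α → G) (N : ℕ) (P : FreeMagma α → Prop) : Subgroup G :=
  Subgroup.closure {g | ∃ t, IsLyndonTree t ∧ (leafWord t).length = N ∧ P t ∧
    treeCommutator x t = g} ⊔ gamma G (N + 1)

theorem gamma_le_lyndonSpan (x : α → G) (N : ℕ) (P : FreeMagma α → Prop) :
    gamma G (N + 1) ≤ lyndonSpan x N P := le_sup_right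

theorem treeCommutator_mem_lyndonSpan (x : α → G) {N : ℕ} {P : FreeMagma α → Prop}
    {t : FreeMagma α} (ht : IsLyndonTree t) (hN : (leafWord t).length = N) (hP : P t) :
    treeCommutator x t ∈ lyndonSpan x N P :=
  Subgroup.mem_sup_left (Subgroup.subset_closure ⟨t, ht, hN, hP, rfl⟩)

theorem lyndonSpan_le {x : α → G} {N : ℕ} {P : FreeMagma α → Prop} {S : Subgroup G}
    (h : ∀ t, IsLyndonTree t → (leafWord t).length = N → P t → treeCommutator x t ∈ S)
    (hS : gamma G (N + 1) ≤ S) : lyndonSpan x N P ≤ S := by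
  refine sup_le ((Subgroup.closure_le _).2 ?_) hS
  rintro _ ⟨t, ht, hN, hP, rfl⟩
  exact h t ht hN hP

theorem lyndonSpan_mono (x : α → G) (N : ℕ) {P Q : FreeMagma α → Prop} (h : ∀ t, P t → Q t) :
    lyndonSpan x N P ≤ lyndonSpan x N Q :=
  lyndonSpan_le (fun _ ht hN hP => treeCommutator_mem_lyndonSpan x ht hN (h _ hP))
    (gamma_le_lyndonSpan x N Q)

theorem lyndonSpan_rightFactorLE_mono (x : α → G) (N : ℕ) {v w : List α} (h : v ≤ w) :
    lyndonSpan x N (RightFactorLE v) ≤ lyndonSpan x N (RightFactorLE w) := by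
  refine lyndonSpan_mono x N fun t ht => ?_
  cases t with
  | of a => trivial
  | mul s t => exact le_trans ht h

/-- For `u < v` with `u = [a, b]` and the bracketing not standard, `b < v`, and the Jacobi identity
reduces to `[[a, v], b]` and `[[b, v], a]`. By induction on `N`, the inner bracket is spanned by
Lyndon trees whose right factor is at most `v`, hence whose words are strictly below `v`; the outer
brackets then have a smaller maximum. The bound on right factors is carried along to make this
second induction close. -/
theorem commutator_mem_lyndonSpan [Finite α] (x : α → G) (N : ℕ) {u v : FreeMagma α}
    (hu : IsLyndonTree u) (hv : IsLyndonTree v)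
    (hN : (leafWord u).length + (leafWord v).length = N) :
    ⁅treeCommutator x u, treeCommutator x v⁆ ∈
      lyndonSpan x N (RightFactorLE (max (leafWord u) (leafWord v))) := by
  induction N using Nat.strong_induction_on generalizing u v with
  | _ N ihN =>
  -- The lexicographic order need not be well-founded on all words, but only finitely many have
  -- bounded length.
  have hwf : {w : List α | w.length ≤ N}.WellFoundedOn (· < ·) :=
    (List.finite_length_le α N).wellFoundedOn
  suffices H : ∀ w ∈ {w : List α | w.length ≤ N}, ∀ u v : FreeMagma α, IsLyndonTree u →
      IsLyndonTree v → (leafWord u).length + (leafWord v).length = N →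
      max (leafWord u) (leafWord v) = w →
      ⁅treeCommutator x u, treeCommutator x v⁆ ∈ lyndonSpan x N (RightFactorLE w) by
    refine H _ ?_ u v hu hv hN rfl
    rcases max_choice (leafWord u) (leafWord v) with h | h <;> rw [h] <;>
      simp only [Set.mem_ofPred_eq] <;> omega
  clear hu hv hN u v
  intro w hw
  refine hwf.induction (P := fun w => ∀ u v : FreeMagma α, IsLyndonTree u →
      IsLyndonTree v → (leafWord u).length + (leafWord v).length = N →
      max (leafWord u) (leafWord v) = w →
      ⁅treeCommutator x u, treeCommutator x v⁆ ∈ lyndonSpan x N (RightFactorLE w)) hw ?_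
  clear hw w
  intro w hw ihw
  have main : ∀ u v : FreeMagma α, IsLyndonTree u → IsLyndonTree v →
      (leafWord u).length + (leafWord v).length = N → leafWord u < leafWord v → leafWord v = w →
      ⁅treeCommutator x u, treeCommutator x v⁆ ∈ lyndonSpan x N (RightFactorLE w) := by
    intro u v hu hv hN huv hvw
    have std : RightFactorGE (leafWord v) u →
        ⁅treeCommutator x u, treeCommutator x v⁆ ∈ lyndonSpan x N (RightFactorLE w) := by
      intro h
      refine treeCommutator_mem_lyndonSpan (t := .mul u v) x ⟨hu, hv, huv, h⟩ ?_ hvw.le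
      simpa [leafWord] using hN
    cases u with
    | of a => exact std trivial
    | mul a b =>
      by_cases hbv : leafWord v ≤ leafWord b
      · exact std hbv
      rw [not_le] at hbv
      have hab : leafWord a < leafWord b := hu.2.2.1
      have hlen : (leafWord a).length + (leafWord b).length + (leafWord v).length = N := by
        simpa [leafWord] using hN
      have swap : ∀ d e : FreeMagma α, IsLyndonTree d → IsLyndonTree e →
          (leafWord d).length + (leafWord v).length + (leafWord e).length = N →
          leafWord d < leafWord v → leafWord e < leafWord v →
          ⁅⁅treeCommutator x d, treeCommutator x v⁆, treeCommutator x e⁆ ∈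
            lyndonSpan x N (RightFactorLE w) := by
        intro d e hd he hl hdv hev
        have hdl := List.length_pos_iff.2 (leafWord_ne_nil d)
        have hel := List.length_pos_iff.2 (leafWord_ne_nil e)
        have hvl := List.length_pos_iff.2 (leafWord_ne_nil v)
        have hS : gamma G ((leafWord d).length + (leafWord v).length + (leafWord e).length + 1) ≤
            lyndonSpan x N (RightFactorLE w) := hl ▸ gamma_le_lyndonSpan x _ _
        have h1 := ihN ((leafWord d).length + (leafWord v).length) (by omega) hd hv rfl
        rw [max_eq_right hdv.le] at h1
        refine (lyndonSpan_le (S := commutatorMemSubgroup hS (treeCommutator_mem_gamma x e))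
          ?_ (gamma_le_commutatorMemSubgroup hS _) h1).2
        intro t ht htl htv
        refine ⟨htl ▸ treeCommutator_mem_gamma x t, ?_⟩
        cases t with
        | of a =>
          simp only [leafWord, List.length_singleton] at htl
          omega
        | mul t₁ t₂ =>
          have htlt : leafWord (.mul t₁ t₂) < leafWord v :=
            lt_of_lt_of_le (ht.2.1.isLyndonWord.append_lt (leafWord_ne_nil _) ht.2.2.1) htv
          have hm : max (leafWord (.mul t₁ t₂)) (leafWord e) < w := hvw ▸ max_lt htlt hev
          refine lyndonSpan_rightFactorLE_mono x N hm.le ?_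
          refine ihw _ ?_ hm _ _ ht he (by omega) rfl
          rcases max_choice (leafWord (.mul t₁ t₂)) (leafWord e) with h | h <;> rw [h] <;>
            simp only [Set.mem_ofPred_eq] <;> omega
      refine commutator_jacobi_mem (hlen ▸ gamma_le_lyndonSpan x _ _)
        (treeCommutator_mem_gamma x a) (treeCommutator_mem_gamma x b)
        (treeCommutator_mem_gamma x v) ?_ ?_
      · exact swap a b hu.1 hu.2.1 (by omega) (hab.trans hbv) hbv
      · exact swap b a hu.2.1 hu.1 (by omega) hbv (hab.trans hbv)
  intro u v hu hv hN hm
  rcases lt_trichotomy (leafWord u) (leafWord v) with h | h | h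
  · rw [max_eq_right h.le] at hm
    exact main u v hu hv hN h hm
  · rw [leafWord_injOn hu hv h, commutatorElement_self]
    exact one_mem _
  · rw [max_eq_left h.le] at hm
    exact commutator_mem_swap (main v u hv hu (by omega) h hm)

/-- If `x` generates `G`, then `γ_k` is generated modulo `γ_{k+1}` by the commutators of the Lyndon
trees with `k` leaves. -/
theorem gamma_le_lyndonSpan_of_closure_eq_top [Finite α] {x : α → G}
    (hx : Subgroup.closure (Set.range x) = ⊤) (k : ℕ) :
    gamma G (k + 1) ≤ lyndonSpan x (k + 1) fun _ => True := by
  induction k with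
  | zero =>
    rw [zero_add, gamma_one, ← hx, Subgroup.closure_le]
    rintro _ ⟨a, rfl⟩
    exact treeCommutator_mem_lyndonSpan (t := .of a) x trivial rfl trivial
  | succ k ih =>
    set S := lyndonSpan x (k + 1 + 1) fun _ => True
    have hS : gamma G (k + 1 + 1 + 1) ≤ S := gamma_le_lyndonSpan x _ _
    have hS' : gamma G (1 + (k + 1) + 1) ≤ S := le_trans (gamma_antitone (by omega)) hS
    rw [gamma_succ G (k + 1) (by omega), Subgroup.commutator_le]
    intro g hg y _
    -- Modulo `γ_{k+3}` the commutator is additive in each argument, so `g` may be a Lyndon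
    -- commutator and `y` a generator.
    have h1 : ∀ a, ⁅g, x a⁆ ∈ S := by
      intro a
      refine (ih.trans (lyndonSpan_le (S := commutatorMemSubgroup (p := k + 1) (q := 1) hS
        (mem_gamma_one (x a))) (fun t ht htl _ => ?_)
        (gamma_le_commutatorMemSubgroup (p := k + 1) (q := 1) hS _)) hg).2
      refine ⟨htl ▸ treeCommutator_mem_gamma x t, ?_⟩
      exact lyndonSpan_mono x _ (fun _ _ => trivial) <|
        commutator_mem_lyndonSpan (v := .of a) x (k + 1 + 1) ht trivial (by simp [htl, leafWord])
    have h2 : Subgroup.closure (Set.range x) ≤ commutatorMemSubgroup hS' hg := by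
      rw [Subgroup.closure_le]
      rintro _ ⟨a, rfl⟩
      exact ⟨mem_gamma_one _, commutator_mem_swap (h1 a)⟩
    rw [hx] at h2
    exact commutator_mem_swap (h2 (Subgroup.mem_top y)).2

end LyndonSpan

/-! ### Representations congruent to 1 modulo a central element. -/

section Filtration

variable {A : Type*} [Ring A] {t : A}

/-- One has `⁅u, v⁆ - 1 = (uv - vu) u⁻¹ v⁻¹`, and the constant terms 1 cancel in `uv - vu`. -/
theorem commutator_units_eq (ht : ∀ a, Commute t a) {u v : Aˣ} {i j : ℕ} {p q : A}
    (hu : (u : A) = 1 + t ^ i * p) (hv : (v : A) = 1 + t ^ j * q) :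
    ((⁅u, v⁆ : Aˣ) : A) =
      1 + t ^ (i + j) * ((p * q - q * p) * (((u⁻¹ : Aˣ) : A) * ((v⁻¹ : Aˣ) : A))) := by
  have h1 : (u : A) * v - v * u = t ^ (i + j) * (p * q - q * p) := by
    have e1 : t ^ i * p * (t ^ j * q) = t ^ (i + j) * (p * q) := by
      rw [mul_assoc, ← mul_assoc p, ← ((ht p).pow_left j).eq, pow_add]
      simp only [mul_assoc]
    have e2 : t ^ j * q * (t ^ i * p) = t ^ (i + j) * (q * p) := by
      rw [mul_assoc, ← mul_assoc q, ← ((ht q).pow_left i).eq, add_comm, pow_add]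
      simp only [mul_assoc]
    rw [hu, hv, mul_sub, ← e1, ← e2]
    noncomm_ring
  have h2 : (v : A) * u * (((u⁻¹ : Aˣ) : A) * ((v⁻¹ : Aˣ) : A)) = 1 := by
    rw [mul_assoc, Units.mul_inv_cancel_left, Units.mul_inv]
  rw [← mul_assoc, ← h1, sub_mul, h2, commutatorElement_def]
  push_cast
  simp only [mul_assoc]
  abel

variable {G : Type*} [Group G]

/-- A representation by units congruent to `1` modulo a central element `t` is congruent to `1`
modulo `t ^ k` on the `k`-th term of the lower central series. -/
theorem exists_eq_one_add_pow_mul (ht : ∀ a, Commute t a) (ρ : G →* Aˣ)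
    (hρ : ∀ g, ∃ y, (ρ g : A) = 1 + t * y) {k : ℕ} {g : G} (hg : g ∈ gamma G k) :
    ∃ y, (ρ g : A) = 1 + t ^ k * y := by
  rcases k with _ | k
  · exact ⟨ρ g - 1, by simp⟩
  induction k generalizing g with
  | zero => simpa using hρ g
  | succ k ih =>
    rw [gamma_succ G (k + 1) (by omega)] at hg
    refine Subgroup.closure_induction (p := fun g _ => ∃ y, (ρ g : A) = 1 + t ^ (k + 1 + 1) * y)
      ?_ ⟨0, by simp⟩ ?_ ?_ hg
    · rintro _ ⟨a, ha, b, -, rfl⟩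
      obtain ⟨p, hp⟩ := ih ha
      obtain ⟨q, hq⟩ := hρ b
      rw [map_commutatorElement]
      exact ⟨_, commutator_units_eq ht hp (hq.trans (by rw [pow_one]))⟩
    · rintro a b - - ⟨p, hp⟩ ⟨q, hq⟩
      refine ⟨p + q + p * (t ^ (k + 1 + 1) * q), ?_⟩
      rw [map_mul, Units.val_mul, hp, hq]
      noncomm_ring
    · rintro a - ⟨p, hp⟩
      refine ⟨-(p * ((ρ a)⁻¹ : Aˣ)), ?_⟩
      rw [map_inv, ← Units.mul_right_inj (ρ a), Units.mul_inv, mul_add, mul_one]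
      have hc := ((ht (ρ a : A)).pow_left (k + 1 + 1)).eq
      rw [← mul_assoc, ← hc, mul_assoc]
      have : (ρ a : A) * -(p * ((ρ a)⁻¹ : Aˣ)) = -p := by
        have hp' : (ρ a : A) * p = p * ρ a := by
          rw [hp, add_mul, mul_add, one_mul, mul_one, ← mul_assoc p,
            ← ((ht p).pow_left (k + 1 + 1)).eq]
        rw [mul_neg, ← mul_assoc, hp', mul_assoc, Units.mul_inv, mul_one]
      rw [this, hp]
      noncomm_ring

end Filtration

/-! ### Leading words of noncommutative polynomials. -/

section LeadingWords

/-- Noncommutative polynomials with integral coefficients. -/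
abbrev NCPoly (α : Type*) := MonoidAlgebra ℤ (FreeMonoid α)

variable {α : Type*} [LinearOrder α]

/-- The polynomial `f` is homogeneous, and `u` is its smallest word and has coefficient `1`. -/
def LeadsWith (f : NCPoly α) (u : List α) : Prop :=
  f.coeff (FreeMonoid.ofList u) = 1 ∧
    ∀ w, f.coeff w ≠ 0 → w.toList.length = u.length ∧ u ≤ w.toList

theorem exists_mul_of_coeff_mul_ne_zero {α : Type*} {f g : NCPoly α} {w : FreeMonoid α}
    (h : (f * g).coeff w ≠ 0) : ∃ a b, f.coeff a ≠ 0 ∧ g.coeff b ≠ 0 ∧ a * b = w := by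
  classical
  rw [MonoidAlgebra.coeff_mul] at h
  obtain ⟨a, ha, h⟩ := Finset.exists_ne_zero_of_sum_ne_zero h
  obtain ⟨b, hb, h⟩ := Finset.exists_ne_zero_of_sum_ne_zero h
  refine ⟨a, b, Finsupp.mem_support_iff.1 ha, Finsupp.mem_support_iff.1 hb, ?_⟩
  by_contra hab
  exact h (if_neg hab)

theorem append_le_append_of_length_eq {u a v b : List α} (hu : a.length = u.length) (hua : u ≤ a)
    (hvb : v ≤ b) : u ++ v ≤ a ++ b := by
  rcases hua.eq_or_lt with rfl | h
  · rcases hvb.eq_or_lt with rfl | h'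
    · exact le_rfl
    · exact ((append_lt_append_left_iff _ _ _).2 h').le
  · refine (append_lt_append_of_lt_of_not_prefix h (fun hp => ?_) v b).le
    rw [hp.eq_of_length hu.symm] at h
    exact lt_irrefl _ h

theorem LeadsWith.mul {f g : NCPoly α} {u v : List α} (hf : LeadsWith f u) (hg : LeadsWith g v) :
    LeadsWith (f * g) (u ++ v) := by
  constructor
  · rw [FreeMonoid.ofList_append, MonoidAlgebra.coeff_mul_mul_of_uniqueMul, hf.1, hg.1, one_mul]
    intro a b ha hb hab
    have hl := (hf.2 a (Finsupp.mem_support_iff.1 ha)).1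
    exact List.append_inj hab hl
  · intro w hw
    obtain ⟨a, b, ha, hb, rfl⟩ := exists_mul_of_coeff_mul_ne_zero hw
    obtain ⟨ha1, ha2⟩ := hf.2 a ha
    obtain ⟨hb1, hb2⟩ := hg.2 b hb
    rw [FreeMonoid.toList_mul]
    exact ⟨by rw [List.length_append, List.length_append, ha1, hb1],
      append_le_append_of_length_eq ha1 ha2 hb2⟩

/-- The words of `g * f` are all at least `v ++ u`, so they cannot cancel the leading term of `f *
g`. -/
theorem LeadsWith.commutator {f g : NCPoly α} {u v : List α} (hf : LeadsWith f u)
    (hg : LeadsWith g v) (h : u ++ v < v ++ u) : LeadsWith (f * g - g * f) (u ++ v) := by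
  have h1 := hf.mul hg
  have h2 := hg.mul hf
  constructor
  · have h3 : (g * f).coeff (FreeMonoid.ofList (u ++ v)) = 0 := by
      by_contra hne
      exact absurd h (not_lt.2 (h2.2 _ hne).2)
    rw [MonoidAlgebra.coeff_sub, Finsupp.sub_apply, h1.1, h3, sub_zero]
  · intro w hw
    rw [MonoidAlgebra.coeff_sub, Finsupp.sub_apply] at hw
    by_cases h3 : (f * g).coeff w = 0
    · obtain ⟨h4, h5⟩ := h2.2 w (fun h => hw (by rw [h3, h, sub_zero]))
      exact ⟨by simpa [add_comm] using h4, h.le.trans h5⟩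
    · exact h1.2 w h3

/-- Polynomials with distinct leading words are linearly independent modulo every integer. -/
theorem dvd_of_dvd_coeff_sum {ι : Type*} {f : ι → NCPoly α} {w : ι → List α}
    (hf : ∀ i, LeadsWith (f i) (w i)) (hw : Function.Injective w) (e : ι →₀ ℤ) (m : ℤ)
    (h : ∀ v, m ∣ (e.sum fun i a => a • f i).coeff v) (i : ι) : m ∣ e i := by
  classical
  by_contra hi
  let T := e.support.filter fun i => ¬ m ∣ e i
  have hT : T.Nonempty :=
    ⟨i, Finset.mem_filter.2 ⟨Finsupp.mem_support_iff.2 fun h0 => hi (h0 ▸ dvd_zero m), hi⟩⟩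
  -- Take the smallest leading word among the coefficients not divisible by `m`: modulo `m`, no
  -- other term contributes to that word.
  obtain ⟨j, hj, hmin⟩ := T.exists_min_image w hT
  obtain ⟨hj1, hj2⟩ := Finset.mem_filter.1 hj
  refine hj2 ?_
  have hsum := h (FreeMonoid.ofList (w j))
  rw [Finsupp.sum, MonoidAlgebra.coeff_sum, Finsupp.finsetSum_apply,
    ← Finset.add_sum_erase _ _ hj1] at hsum
  rw [MonoidAlgebra.coeff_smul_apply, (hf j).1, smul_eq_mul, mul_one] at hsum
  refine (dvd_add_left (Finset.dvd_sum fun l hl => ?_)).1 hsum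
  rw [MonoidAlgebra.coeff_smul_apply, smul_eq_mul]
  obtain ⟨hlj, hl⟩ := Finset.mem_erase.1 hl
  by_cases hml : m ∣ e l
  · exact hml.mul_right _
  · have h1 := hmin l (Finset.mem_filter.2 ⟨hl, hml⟩)
    by_cases h0 : (f l).coeff (FreeMonoid.ofList (w j)) = 0
    · rw [h0, mul_zero]
      exact dvd_zero m
    · exact absurd (hw (le_antisymm ((hf l).2 _ h0).2 h1)) hlj

end LeadingWords

/-! ### The Magnus expansion and its leading terms. -/

section Magnus

variable {α : Type*}

/-- A generator of the ring of noncommutative polynomials. -/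
noncomputable def ncVar (i : α) : NCPoly α := MonoidAlgebra.single (FreeMonoid.of i) 1

/-- The central power series variable records the degree, so the degree filtration becomes
divisibility by its powers. -/
theorem isUnit_magnus (i : α) :
    IsUnit (1 + PowerSeries.X * PowerSeries.C (ncVar i) : PowerSeries (NCPoly α)) := by
  rw [PowerSeries.isUnit_iff_constantCoeff]
  simp

/-- The Magnus representation of a free group, sending the free generator `i` to `1 + t X_i`. -/
noncomputable def magnus (α : Type*) : FreeGroup α →* (PowerSeries (NCPoly α))ˣ :=
  FreeGroup.lift fun i => (isUnit_magnus i).unit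

theorem magnus_of (i : α) : (magnus α (FreeGroup.of i) : PowerSeries (NCPoly α)) =
    1 + PowerSeries.X * PowerSeries.C (ncVar i) := by
  simp [magnus]

theorem X_commute (a : PowerSeries (NCPoly α)) : Commute PowerSeries.X a :=
  (PowerSeries.commute_X a).symm

theorem constantCoeff_magnus (g : FreeGroup α) :
    PowerSeries.constantCoeff (magnus α g : PowerSeries (NCPoly α)) = 1 := by
  have h : (Units.map (PowerSeries.constantCoeff (R := NCPoly α)).toMonoidHom).comp (magnus α) =
      1 := by
    ext i : 1
    ext : 1
    simp [magnus_of]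
  simpa using congrArg Units.val (DFunLike.congr_fun h g)

theorem exists_magnus_eq {k : ℕ} {g : FreeGroup α} (hg : g ∈ gamma (FreeGroup α) k) :
    ∃ y, (magnus α g : PowerSeries (NCPoly α)) = 1 + PowerSeries.X ^ k * y := by
  refine exists_eq_one_add_pow_mul X_commute (magnus α) (fun g => ?_) hg
  have := PowerSeries.sub_const_eq_X_mul_shift (magnus α g : PowerSeries (NCPoly α))
  rw [constantCoeff_magnus, map_one, sub_eq_iff_eq_add'] at this
  exact ⟨_, this⟩

/-- The component of degree `k` of the Magnus expansion. -/
noncomputable def magnusCoeff (k : ℕ) (g : FreeGroup α) : NCPoly α :=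
  PowerSeries.coeff k (magnus α g : PowerSeries (NCPoly α))

theorem magnusCoeff_eq {k : ℕ} (hk : k ≠ 0) {g : FreeGroup α} {y : PowerSeries (NCPoly α)}
    (h : (magnus α g : PowerSeries (NCPoly α)) = 1 + PowerSeries.X ^ k * y) :
    magnusCoeff k g = PowerSeries.constantCoeff y := by
  have := PowerSeries.coeff_X_pow_mul y k 0
  rw [zero_add] at this
  rw [magnusCoeff, h, map_add, this, PowerSeries.coeff_one, if_neg hk, zero_add,
    PowerSeries.coeff_zero_eq_constantCoeff_apply]

theorem magnusCoeff_one_of (i : α) : magnusCoeff 1 (FreeGroup.of i) = ncVar i := by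
  rw [magnusCoeff_eq one_ne_zero (y := PowerSeries.C (ncVar i)) (by rw [magnus_of, pow_one])]
  simp

theorem magnusCoeff_mul {k : ℕ} (hk : k ≠ 0) {g h : FreeGroup α}
    (hg : g ∈ gamma (FreeGroup α) k) (hh : h ∈ gamma (FreeGroup α) k) :
    magnusCoeff k (g * h) = magnusCoeff k g + magnusCoeff k h := by
  obtain ⟨p, hp⟩ := exists_magnus_eq hg
  obtain ⟨q, hq⟩ := exists_magnus_eq hh
  rw [magnusCoeff_eq hk hp, magnusCoeff_eq hk hq,
    magnusCoeff_eq hk (y := p + q + p * (PowerSeries.X ^ k * q))]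
  · simp [hk]
  · rw [map_mul, Units.val_mul, hp, hq]
    noncomm_ring

theorem magnusCoeff_commutator {i j : ℕ} (hi : i ≠ 0) (hj : j ≠ 0) {g h : FreeGroup α}
    (hg : g ∈ gamma (FreeGroup α) i) (hh : h ∈ gamma (FreeGroup α) j) :
    magnusCoeff (i + j) ⁅g, h⁆ =
      magnusCoeff i g * magnusCoeff j h - magnusCoeff j h * magnusCoeff i g := by
  obtain ⟨p, hp⟩ := exists_magnus_eq hg
  obtain ⟨q, hq⟩ := exists_magnus_eq hh
  have e := commutator_units_eq X_commute hp hq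
  rw [← map_commutatorElement] at e
  rw [magnusCoeff_eq (by omega) e, magnusCoeff_eq hi hp, magnusCoeff_eq hj hq]
  rw [← map_inv, ← map_inv, map_mul, map_mul, constantCoeff_magnus, constantCoeff_magnus]
  simp

theorem magnusCoeff_eq_zero {k : ℕ} (hk : k ≠ 0) {g : FreeGroup α}
    (hg : g ∈ gamma (FreeGroup α) (k + 1)) : magnusCoeff k g = 0 := by
  obtain ⟨p, hp⟩ := exists_magnus_eq hg
  rw [magnusCoeff_eq hk (y := PowerSeries.X * p) (by rw [hp, pow_succ, mul_assoc])]
  simp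

theorem leadsWith_ncVar [LinearOrder α] (i : α) : LeadsWith (ncVar i) [i] := by
  constructor
  · simp [ncVar]
  · intro w hw
    have : FreeMonoid.of i = w := by
      by_contra h
      simp [ncVar, MonoidAlgebra.coeff_single, h] at hw
    subst this
    exact ⟨rfl, le_rfl⟩

/-- Leading terms turn group commutators into ring commutators. For Lyndon factors `s < t` one has
`st < t < ts`, so `LeadsWith.commutator` applies. -/
theorem leadsWith_magnusCoeff [LinearOrder α] {t : FreeMagma α} (ht : IsLyndonTree t) :
    LeadsWith (magnusCoeff (leafWord t).length (treeCommutator FreeGroup.of t)) (leafWord t) := by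
  induction t using FreeMagma.recOnMul with
  | ih1 a =>
    have h := leadsWith_ncVar a
    rwa [← magnusCoeff_one_of] at h
  | ih2 s t hs ht' =>
    obtain ⟨h1, h2, h3, -⟩ := ht
    have hl : leafWord s ++ leafWord t < leafWord t ++ leafWord s :=
      (h2.isLyndonWord.append_lt (leafWord_ne_nil s) h3).trans
        (lt_append_of_ne_nil _ (leafWord_ne_nil s))
    have h := (hs h1).commutator (ht' h2) hl
    rw [← magnusCoeff_commutator (List.length_pos_iff.2 (leafWord_ne_nil s)).ne'
      (List.length_pos_iff.2 (leafWord_ne_nil t)).ne' (treeCommutator_mem_gamma _ s)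
      (treeCommutator_mem_gamma _ t), ← List.length_append] at h
    exact h

end Magnus

/-! ### The groups `γ_k/γ_{k+1}` of a free group as pure subgroups of the polynomials. -/

section GradedQuotient

/-- The quotient `γ_k / γ_{k+1}`. -/
abbrev GammaQuotient (G : Type*) [Group G] (k : ℕ) : Type _ :=
  gamma G k ⧸ (gamma G (k + 1)).subgroupOf (gamma G k)

instance gammaQuotientCommGroup (G : Type*) [Group G] (k : ℕ) : CommGroup (GammaQuotient G k) :=
  { (inferInstance : Group (GammaQuotient G k)) with
    mul_comm := by
      intro a b
      obtain ⟨x, rfl⟩ := QuotientGroup.mk_surjective a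
      obtain ⟨y, rfl⟩ := QuotientGroup.mk_surjective b
      rw [← QuotientGroup.mk_mul, ← QuotientGroup.mk_mul, QuotientGroup.eq,
        Subgroup.mem_subgroupOf]
      have h : (((x * y)⁻¹ * (y * x) : gamma G k) : G) = ⁅(y : G)⁻¹, (x : G)⁻¹⁆ := by
        simp [commutatorElement_def, mul_assoc]
      rw [h]
      exact gamma_antitone (by omega) (commutator_mem_gamma (mem_gamma_one _) (inv_mem x.2)) }

variable {α : Type*}

/-- The leading term of the Magnus expansion on `γ_k / γ_{k+1}`. -/
noncomputable def leadingTerm (α : Type*) (k : ℕ) :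
    Additive (GammaQuotient (FreeGroup α) (k + 1)) →+ NCPoly α :=
  MonoidHom.toAdditiveLeft <| QuotientGroup.lift _
    ({ toFun := fun g => Multiplicative.ofAdd (magnusCoeff (k + 1) (g : FreeGroup α))
       map_one' := by
        rw [OneMemClass.coe_one, magnusCoeff_eq_zero k.succ_ne_zero (one_mem _), ofAdd_zero]
       map_mul' := fun g h => by
        rw [Subgroup.coe_mul, magnusCoeff_mul k.succ_ne_zero g.2 h.2, ofAdd_add] } :
      gamma (FreeGroup α) (k + 1) →* Multiplicative (NCPoly α))
    (fun g hg => by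
      rw [Subgroup.mem_subgroupOf] at hg
      rw [MonoidHom.mem_ker, MonoidHom.coe_mk, OneHom.coe_mk,
        magnusCoeff_eq_zero k.succ_ne_zero hg, ofAdd_zero])

variable [LinearOrder α]

/-- The Lyndon trees with `k` leaves. -/
abbrev LyndonTree (α : Type*) [LinearOrder α] (k : ℕ) :=
  {t : FreeMagma α // IsLyndonTree t ∧ (leafWord t).length = k}

/-- The class in `γ_k / γ_{k+1}` of the commutator described by a Lyndon tree. -/
def lyndonClass {k : ℕ} (t : LyndonTree α k) : Additive (GammaQuotient (FreeGroup α) k) :=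
  Additive.ofMul (QuotientGroup.mk ⟨treeCommutator FreeGroup.of t.1,
    by simpa only [t.2.2] using treeCommutator_mem_gamma FreeGroup.of t.1⟩)

theorem leadsWith_leadingTerm {k : ℕ} (t : LyndonTree α (k + 1)) :
    LeadsWith (leadingTerm α k (lyndonClass t)) (leafWord t.1) := by
  have h := leadsWith_magnusCoeff t.2.1
  rw [t.2.2] at h
  exact h

theorem leafWord_lyndonTree_injective (k : ℕ) :
    Function.Injective fun t : LyndonTree α k => leafWord t.1 :=
  fun s t h => Subtype.ext (leafWord_injOn s.2.1 t.2.1 h)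

theorem span_lyndonClass [Finite α] (k : ℕ) :
    Submodule.span ℤ (Set.range (lyndonClass (α := α) (k := k + 1))) = ⊤ := by
  rw [eq_top_iff]
  rintro x -
  obtain ⟨⟨g, hg⟩, hx⟩ := QuotientGroup.mk_surjective x.toMul
  obtain rfl : x = Additive.ofMul (QuotientGroup.mk ⟨g, hg⟩) := hx.symm
  set M := Submodule.span ℤ (Set.range (lyndonClass (α := α) (k := k + 1)))
  -- The preimage of the span in the free group, where the generation result for `γ_{k+1}` applies.
  let S : Subgroup (FreeGroup α) :=
    ((AddSubgroup.toSubgroup M.toAddSubgroup).comap (QuotientGroup.mk' _)).map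
      (gamma (FreeGroup α) (k + 1)).subtype
  have hmem : ∀ (a : FreeGroup α) (ha : a ∈ gamma (FreeGroup α) (k + 1)),
      a ∈ S ↔ Additive.ofMul (QuotientGroup.mk ⟨a, ha⟩ : GammaQuotient _ _) ∈ M := by
    intro a ha
    constructor
    · rintro ⟨⟨b, hb⟩, h, rfl⟩
      exact h
    · exact fun h => ⟨⟨a, ha⟩, h, rfl⟩
  have hle : lyndonSpan FreeGroup.of (k + 1) (fun _ => True) ≤ S := by
    refine lyndonSpan_le (fun t ht htl _ => ?_) (fun a ha => ?_)
    · rw [hmem _ (htl ▸ treeCommutator_mem_gamma FreeGroup.of t)]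
      exact Submodule.subset_span ⟨⟨t, ht, htl⟩, rfl⟩
    · rw [hmem _ (gamma_antitone (by omega) ha)]
      have h0 : (QuotientGroup.mk ⟨a, gamma_antitone (Nat.le_succ _) ha⟩ :
          GammaQuotient (FreeGroup α) (k + 1)) = 1 := by
        rw [QuotientGroup.eq_one_iff, Subgroup.mem_subgroupOf]
        exact ha
      rw [h0]
      exact zero_mem M
  exact (hmem g hg).1 (hle (gamma_le_lyndonSpan_of_closure_eq_top
    (FreeGroup.closure_range_of α) k hg))

theorem exists_eq_sum_lyndonClass [Finite α] {k : ℕ}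
    (x : Additive (GammaQuotient (FreeGroup α) (k + 1))) :
    ∃ e : LyndonTree α (k + 1) →₀ ℤ, (e.sum fun t a => a • lyndonClass t) = x := by
  have hx : x ∈ Submodule.span ℤ (Set.range (lyndonClass (α := α) (k := k + 1))) := by
    rw [span_lyndonClass]
    trivial
  exact Finsupp.mem_span_range_iff_exists_finsupp.1 hx

/-- The leading terms of the Magnus expansion form a pure subgroup. -/
theorem exists_eq_smul_of_dvd_leadingTerm [Finite α] {k : ℕ}
    (x : Additive (GammaQuotient (FreeGroup α) (k + 1))) (m : ℤ)
    (h : ∀ v, m ∣ (leadingTerm α k x).coeff v) : ∃ y, x = m • y := by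
  obtain ⟨e, rfl⟩ := exists_eq_sum_lyndonClass x
  simp only [map_finsuppSum, map_zsmul] at h
  have hd := dvd_of_dvd_coeff_sum leadsWith_leadingTerm (leafWord_lyndonTree_injective (k + 1)) e m
    h
  choose c hc using hd
  refine ⟨∑ t ∈ e.support, c t • lyndonClass t, ?_⟩
  rw [Finset.smul_sum]
  refine Finset.sum_congr rfl fun t _ => ?_
  simp only [hc t, mul_smul]

theorem leadingTerm_injective [Finite α] (k : ℕ) : Function.Injective (leadingTerm α k) := by
  rw [injective_iff_map_eq_zero]
  intro x hx
  -- Purity for `m = 0` is injectivity.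
  obtain ⟨y, rfl⟩ := exists_eq_smul_of_dvd_leadingTerm x 0 (by simp [hx])
  simp

instance finite_lyndonTree [Finite α] (k : ℕ) : Finite (LyndonTree α k) := by
  have := (List.finite_length_eq α k).to_subtype
  exact Finite.of_injective (β := {l : List α | l.length = k}) (fun t => ⟨leafWord t.1, t.2.2⟩)
    fun s t h => leafWord_lyndonTree_injective k (congrArg Subtype.val h)

instance finite_gammaQuotient [Finite α] (k : ℕ) :
    Module.Finite ℤ (Additive (GammaQuotient (FreeGroup α) (k + 1))) :=
  ⟨⟨(Set.finite_range (lyndonClass (α := α) (k := k + 1))).toFinset, by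
    rw [Set.Finite.coe_toFinset, span_lyndonClass]⟩⟩

/-- Leading terms are homogeneous. -/
theorem length_of_coeff_leadingTerm_ne_zero [Finite α] {k : ℕ}
    (x : Additive (GammaQuotient (FreeGroup α) (k + 1))) {w : FreeMonoid α}
    (h : (leadingTerm α k x).coeff w ≠ 0) : w.toList.length = k + 1 := by
  obtain ⟨e, rfl⟩ := exists_eq_sum_lyndonClass x
  rw [map_finsuppSum, Finsupp.sum, MonoidAlgebra.coeff_sum, Finsupp.finsetSum_apply] at h
  obtain ⟨t, -, ht⟩ := Finset.exists_ne_zero_of_sum_ne_zero h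
  rw [map_zsmul, MonoidAlgebra.coeff_smul_apply, smul_eq_mul] at ht
  rw [((leadsWith_leadingTerm t).2 w (right_ne_zero_of_mul ht)).1, t.2.2]

end GradedQuotient

/-! ### Commutators with the variables, and the centre modulo `γ_{c+1}`. -/

section Coefficients

variable {α : Type*}

theorem coeff_mul_ncVar (P : NCPoly α) (w : FreeMonoid α) (i : α) :
    (P * ncVar i).coeff (w * FreeMonoid.of i) = P.coeff w := by
  rw [ncVar, MonoidAlgebra.coeff_mul_single_mul, mul_one]

theorem coeff_ncVar_mul (P : NCPoly α) (w : FreeMonoid α) (i : α) :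
    (ncVar i * P).coeff (FreeMonoid.of i * w) = P.coeff w := by
  rw [ncVar, MonoidAlgebra.coeff_single_mul_mul, one_mul]

theorem coeff_ncVar_mul_of_ne (P : NCPoly α) (w : FreeMonoid α) {i j : α} (h : i ≠ j) :
    (ncVar i * P).coeff (FreeMonoid.of j * w) = 0 := by
  refine MonoidAlgebra.coeff_single_mul_of_forall_mul_ne _ _ fun d hd => h ?_
  exact (List.cons.inj (show i :: d.toList = j :: w.toList from hd)).1

/-- A polynomial without constant term whose commutators with all the variables are divisible by
`m` is divisible by `m`. -/
theorem dvd_coeff_of_dvd_commutator [Nontrivial α] {P : NCPoly α} {m : ℤ} (h1 : P.coeff 1 = 0)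
    (h : ∀ i w, m ∣ (P * ncVar i - ncVar i * P).coeff w) (w : FreeMonoid α) : m ∣ P.coeff w := by
  induction w using FreeMonoid.casesOn with
  | one => rw [h1]; exact dvd_zero m
  | of_mul j u =>
    obtain ⟨i, hij⟩ := exists_ne j
    -- Words of `X_i P` begin with `i ≠ j`, so the coefficient of this word comes from `P X_i`
    -- alone.
    have := h i (FreeMonoid.of j * u * FreeMonoid.of i)
    rwa [MonoidAlgebra.coeff_sub, Finsupp.sub_apply, coeff_mul_ncVar, mul_assoc,
      coeff_ncVar_mul_of_ne _ _ hij, sub_zero] at this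

theorem magnusCoeff_commutator_of {k : ℕ} (hk : k ≠ 0) {g : FreeGroup α}
    (hg : g ∈ gamma (FreeGroup α) k) (i : α) :
    magnusCoeff (k + 1) ⁅g, FreeGroup.of i⁆ =
      magnusCoeff k g * ncVar i - ncVar i * magnusCoeff k g := by
  rw [magnusCoeff_commutator hk one_ne_zero hg (mem_gamma_one _), magnusCoeff_one_of]

variable [LinearOrder α] [Finite α]

theorem mem_gamma_succ_of_magnusCoeff_eq_zero {k : ℕ} (hk : k ≠ 0) {g : FreeGroup α}
    (hg : g ∈ gamma (FreeGroup α) k) (h : magnusCoeff k g = 0) :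
    g ∈ gamma (FreeGroup α) (k + 1) := by
  obtain ⟨k, rfl⟩ := Nat.exists_eq_succ_of_ne_zero hk
  have h1 : Additive.ofMul (QuotientGroup.mk ⟨g, hg⟩ : GammaQuotient (FreeGroup α) (k + 1)) = 0 :=
    leadingTerm_injective k (by rw [map_zero]; exact h)
  rw [ofMul_eq_zero, QuotientGroup.eq_one_iff, Subgroup.mem_subgroupOf] at h1
  exact h1

theorem length_of_coeff_magnusCoeff_ne_zero {k : ℕ} (hk : k ≠ 0) {g : FreeGroup α}
    (hg : g ∈ gamma (FreeGroup α) k) {w : FreeMonoid α} (h : (magnusCoeff k g).coeff w ≠ 0) :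
    w.toList.length = k := by
  obtain ⟨k, rfl⟩ := Nat.exists_eq_succ_of_ne_zero hk
  exact length_of_coeff_leadingTerm_ne_zero
    (Additive.ofMul (QuotientGroup.mk ⟨g, hg⟩ : GammaQuotient (FreeGroup α) (k + 1))) h

theorem coeff_one_magnusCoeff {k : ℕ} (hk : k ≠ 0) {g : FreeGroup α}
    (hg : g ∈ gamma (FreeGroup α) k) : (magnusCoeff k g).coeff 1 = 0 := by
  by_contra h
  exact hk (length_of_coeff_magnusCoeff_ne_zero hk hg h).symm

/-- The centre of the quotient of a free group by a term of the lower central series. -/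
theorem mem_gamma_of_forall_commutator_mem [Nontrivial α] {c : ℕ} {g : FreeGroup α}
    (h : ∀ i, ⁅g, FreeGroup.of i⁆ ∈ gamma (FreeGroup α) (c + 1)) : g ∈ gamma (FreeGroup α) c := by
  suffices H : ∀ k ≤ c, g ∈ gamma (FreeGroup α) k from H c le_rfl
  intro k
  induction k with
  | zero => exact fun _ => Subgroup.mem_top g
  | succ k ih =>
    intro hk
    rcases eq_or_ne k 0 with rfl | hk0
    · exact mem_gamma_one g
    have hg := ih (by omega)
    refine mem_gamma_succ_of_magnusCoeff_eq_zero hk0 hg ?_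
    rw [← MonoidAlgebra.coeff_eq_zero]
    ext w
    -- Vanishing is divisibility by 0, so the divisibility lemma is used with `m = 0`.
    rw [Finsupp.zero_apply, ← zero_dvd_iff]
    refine dvd_coeff_of_dvd_commutator (coeff_one_magnusCoeff hk0 hg) (fun i v => ?_) w
    rw [← magnusCoeff_commutator_of hk0 hg,
      magnusCoeff_eq_zero k.succ_ne_zero (gamma_antitone (by omega) (h i))]
    simp

end Coefficients

/-! ### The Andreadakis filtration and the Johnson homomorphism. -/

section Andreadakis

variable {n : ℕ}

theorem mem_andreadakis_iff {c : ℕ} {φ : MulAut (FreeGroup (Fin n))} :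
    φ ∈ andreadakis n c ↔ ∀ g, φ g * g⁻¹ ∈ gamma (FreeGroup (Fin n)) (c + 1) := by
  have h : ∀ g, φ g * g⁻¹ ∈ gamma (FreeGroup (Fin n)) (c + 1) ↔
      autQuotient (gamma (FreeGroup (Fin n)) (c + 1)) φ (QuotientGroup.mk g) =
        QuotientGroup.mk g := fun g => by
    rw [← div_eq_mul_inv]
    exact (QuotientGroup.eq_iff_div_mem).symm
  simp only [h]
  rw [andreadakis, MonoidHom.mem_ker]
  constructor
  · intro h g
    rw [h, MulAut.one_apply]
  · intro h
    ext x
    obtain ⟨g, rfl⟩ := QuotientGroup.mk_surjective x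
    exact h g

theorem mem_andreadakis_iff_of {c : ℕ} {φ : MulAut (FreeGroup (Fin n))} :
    φ ∈ andreadakis n c ↔ ∀ i, φ (FreeGroup.of i) * (FreeGroup.of i)⁻¹ ∈
      gamma (FreeGroup (Fin n)) (c + 1) := by
  rw [mem_andreadakis_iff]
  refine ⟨fun h i => h _, fun h g => ?_⟩
  have he : (QuotientGroup.mk' (gamma (FreeGroup (Fin n)) (c + 1))).comp φ.toMonoidHom =
      QuotientGroup.mk' (gamma (FreeGroup (Fin n)) (c + 1)) := by
    ext i
    have := h i
    rw [← div_eq_mul_inv] at this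
    exact QuotientGroup.eq_iff_div_mem.2 this
  rw [← div_eq_mul_inv]
  exact QuotientGroup.eq_iff_div_mem.1 (DFunLike.congr_fun he g)

theorem andreadakis_antitone (n : ℕ) : Antitone (andreadakis n) := fun _ _ h φ hφ => by
  rw [mem_andreadakis_iff] at *
  exact fun g => gamma_antitone (by omega) (hφ g)

theorem conj_mem_andreadakis_iff {c : ℕ} {g : FreeGroup (Fin n)} :
    MulAut.conj g ∈ andreadakis n c ↔
      ∀ i, ⁅g, FreeGroup.of i⁆ ∈ gamma (FreeGroup (Fin n)) (c + 1) := by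
  rw [mem_andreadakis_iff_of]
  rfl

theorem conj_mem_andreadakis {c : ℕ} {g : FreeGroup (Fin n)}
    (hg : g ∈ gamma (FreeGroup (Fin n)) c) : MulAut.conj g ∈ andreadakis n c :=
  conj_mem_andreadakis_iff.2 fun _ => commutator_mem_gamma hg (mem_gamma_one _)

/-- An automorphism acting trivially on `G / γ_2` acts trivially on `γ_k / γ_{k+1}`. -/
theorem apply_mul_inv_mem_gamma_succ {G : Type*} [Group G] {φ : MulAut G}
    (hφ : ∀ g, φ g * g⁻¹ ∈ gamma G 2) {k : ℕ} {g : G} (hg : g ∈ gamma G (k + 1)) :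
    φ g * g⁻¹ ∈ gamma G (k + 2) := by
  induction k generalizing g with
  | zero => exact hφ g
  | succ k ih =>
    rw [gamma_succ G (k + 1) (by omega)] at hg
    let π := QuotientGroup.mk' (gamma G (k + 1 + 2))
    have hle : ⁅gamma G (k + 1), (⊤ : Subgroup G)⁆ ≤ (π.comp φ.toMonoidHom).eqLocus π := by
      rw [Subgroup.commutator_le]
      intro a ha b _
      have hπ : ∀ x y : G, x * y⁻¹ ∈ gamma G (k + 1 + 2) → π x = π y := fun x y h =>
        QuotientGroup.eq_iff_div_mem.2 (by rwa [div_eq_mul_inv])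
      change π (φ ⁅a, b⁆) = π ⁅a, b⁆
      rw [map_commutatorElement]
      -- The entries are changed one at a time: `a` moves by `γ_{k+2}` and `b` by `γ_2`, so each
      -- change costs an element of `γ_{k+3}`.
      trans π ⁅a, φ b⁆
      · have e := commutatorElement_mul_left_eq_conj_mul (φ a * a⁻¹) a (φ b)
        rw [inv_mul_cancel_right] at e
        have h1 : ⁅φ a * a⁻¹, ⁅a, φ b⁆⁆ ∈ gamma G (k + 1 + 2) := gamma_antitone (by omega)
          (commutator_mem_gamma (ih ha) (commutator_mem_gamma ha (mem_gamma_one (φ b))))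
        have h2 : ⁅φ a * a⁻¹, φ b⁆ ∈ gamma G (k + 1 + 2) := gamma_antitone (by omega)
          (commutator_mem_gamma (ih ha) (mem_gamma_one (φ b)))
        refine hπ _ _ ?_
        have h3 := mul_mem h1 ((inferInstance : (gamma G (k + 1 + 2)).Normal).conj_mem _ h2
          ⁅a, φ b⁆)
        convert h3 using 1
        rw [e, commutatorElement_def (φ a * a⁻¹) ⁅a, φ b⁆]
        group
      · have e := commutatorElement_mul_right_eq_mul_conj a (φ b * b⁻¹) b
        rw [inv_mul_cancel_right] at e
        have h1 : ⁅a, φ b * b⁻¹⁆ ∈ gamma G (k + 1 + 2) :=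
          commutator_mem_gamma ha (hφ b)
        have h2 : ⁅φ b * b⁻¹, ⁅a, b⁆⁆ ∈ gamma G (k + 1 + 2) := gamma_antitone (by omega)
          (commutator_mem_gamma (hφ b) (commutator_mem_gamma ha (mem_gamma_one b)))
        refine hπ _ _ ?_
        convert mul_mem h1 h2 using 1
        rw [e, commutatorElement_def (φ b * b⁻¹) ⁅a, b⁆]
        group
    rw [← div_eq_mul_inv]
    exact QuotientGroup.eq_iff_div_mem.1 (hle hg)

/-- The Johnson homomorphism on the `c`-th term of the Andreadakis filtration, sending `φ` to the
classes of `φ(x_i) x_i⁻¹` in `γ_{c+1} / γ_{c+2}`. -/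
noncomputable def johnson (n c : ℕ) (hc : 1 ≤ c) : andreadakis n c →*
    Multiplicative (Fin n → Additive (GammaQuotient (FreeGroup (Fin n)) (c + 1))) where
  toFun φ := Multiplicative.ofAdd fun i => Additive.ofMul <| QuotientGroup.mk
    ⟨φ.1 (FreeGroup.of i) * (FreeGroup.of i)⁻¹, mem_andreadakis_iff.1 φ.2 _⟩
  map_one' := by
    refine congrArg Multiplicative.ofAdd (funext fun i => ?_)
    simp only [OneMemClass.coe_one, MulAut.one_apply, mul_inv_cancel]
    rfl
  map_mul' φ ψ := by
    refine congrArg Multiplicative.ofAdd (funext fun i => ?_)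
    change _ = Additive.ofMul (_ * _)
    refine congrArg Additive.ofMul ?_
    have h1 : φ.1 ∈ andreadakis n 1 := andreadakis_antitone n hc φ.2
    have h2 := mem_andreadakis_iff.1 ψ.2 (FreeGroup.of i)
    -- Additivity follows from `φψ(x) x⁻¹ = φ(ψ(x) x⁻¹) · φ(x) x⁻¹`, as `φ` acts trivially on
    -- `γ_{c+1}/γ_{c+2}`.
    have h3 := apply_mul_inv_mem_gamma_succ (mem_andreadakis_iff.1 h1) h2
    rw [mul_comm]
    change (QuotientGroup.mk _ : GammaQuotient (FreeGroup (Fin n)) (c + 1)) =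
      QuotientGroup.mk (_ * _)
    rw [QuotientGroup.eq_iff_div_mem, Subgroup.mem_subgroupOf]
    convert h3 using 1
    simp [div_eq_mul_inv, mul_assoc]

theorem johnson_eq_one_iff {c : ℕ} (hc : 1 ≤ c) (φ : andreadakis n c) :
    johnson n c hc φ = 1 ↔ φ.1 ∈ andreadakis n (c + 1) := by
  rw [mem_andreadakis_iff_of]
  have : johnson n c hc φ = 1 ↔ ∀ i, (QuotientGroup.mk
      ⟨φ.1 (FreeGroup.of i) * (FreeGroup.of i)⁻¹, mem_andreadakis_iff.1 φ.2 _⟩ :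
        GammaQuotient (FreeGroup (Fin n)) (c + 1)) = 1 := funext_iff
  rw [this]
  simp only [QuotientGroup.eq_one_iff, Subgroup.mem_subgroupOf]

theorem leadingTerm_johnson_conj {c : ℕ} (hc : 1 ≤ c) {g : FreeGroup (Fin n)}
    (hg : g ∈ gamma (FreeGroup (Fin n)) c) (i : Fin n) :
    leadingTerm (Fin n) c
        ((johnson n c hc ⟨MulAut.conj g, conj_mem_andreadakis hg⟩).toAdd i) =
      magnusCoeff c g * ncVar i - ncVar i * magnusCoeff c g := by
  rw [← magnusCoeff_commutator_of (by omega) hg]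
  rfl

/-- The image of the inner automorphisms under the Johnson homomorphism. -/
noncomputable def innerJohnson (n c : ℕ) (hc : 1 ≤ c) :
    AddSubgroup (Fin n → Additive (GammaQuotient (FreeGroup (Fin n)) (c + 1))) :=
  Subgroup.toAddSubgroup'
    (((MulAut.conj (G := FreeGroup (Fin n))).range.subgroupOf (andreadakis n c)).map
      (johnson n c hc))

theorem mem_innerJohnson_iff {c : ℕ} (hc : 1 ≤ c)
    {v : Fin n → Additive (GammaQuotient (FreeGroup (Fin n)) (c + 1))} :
    v ∈ innerJohnson n c hc ↔ ∃ (g : FreeGroup (Fin n)) (hg : MulAut.conj g ∈ andreadakis n c),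
      (johnson n c hc ⟨MulAut.conj g, hg⟩).toAdd = v := by
  constructor
  · rintro ⟨⟨_, hφ⟩, ⟨g, rfl⟩, rfl⟩
    exact ⟨g, hφ, rfl⟩
  · rintro ⟨g, hg, rfl⟩
    exact ⟨⟨MulAut.conj g, hg⟩, ⟨g, rfl⟩, rfl⟩

/-- The image of the inner automorphisms under the Johnson homomorphism is pure. -/
theorem mem_innerJohnson_of_smul_mem [Nontrivial (Fin n)] {c : ℕ} (hc : 1 ≤ c)
    {v : Fin n → Additive (GammaQuotient (FreeGroup (Fin n)) (c + 1))} {m : ℤ} (hm : m ≠ 0)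
    (h : m • v ∈ innerJohnson n c hc) : v ∈ innerJohnson n c hc := by
  rw [mem_innerJohnson_iff] at *
  obtain ⟨g, hφ, hv⟩ := h
  have hg : g ∈ gamma (FreeGroup (Fin n)) c :=
    mem_gamma_of_forall_commutator_mem (conj_mem_andreadakis_iff.1 hφ)
  -- Thus `m` divides the commutators of the leading term of `g` with all variables, hence that
  -- leading term itself; by purity `g` is an `m`-th power of some `k` modulo `γ_{c+1}`, and `k`
  -- realizes `v`.
  have h1 : ∀ i, m • leadingTerm (Fin n) c (v i) =
      magnusCoeff c g * ncVar i - ncVar i * magnusCoeff c g := fun i => by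
    rw [← leadingTerm_johnson_conj hc hg, hv, Pi.smul_apply, map_zsmul]
  obtain ⟨d, rfl⟩ := Nat.exists_eq_add_of_le' hc
  have h2 : ∀ w, m ∣ (magnusCoeff (d + 1) g).coeff w :=
    dvd_coeff_of_dvd_commutator (coeff_one_magnusCoeff (by omega) hg) fun i w => by
      rw [← h1, MonoidAlgebra.coeff_smul_apply, smul_eq_mul]
      exact dvd_mul_right _ _
  obtain ⟨y, hy⟩ := exists_eq_smul_of_dvd_leadingTerm
    (Additive.ofMul (QuotientGroup.mk ⟨g, hg⟩ : GammaQuotient (FreeGroup (Fin n)) (d + 1))) m h2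
  obtain ⟨⟨k, hk⟩, hky⟩ := QuotientGroup.mk_surjective y.toMul
  obtain rfl : y = Additive.ofMul (QuotientGroup.mk ⟨k, hk⟩) := hky.symm
  have h3 : magnusCoeff (d + 1) g = m • magnusCoeff (d + 1) k := by
    have := congrArg (leadingTerm (Fin n) d) hy
    rwa [map_zsmul] at this
  refine ⟨k, conj_mem_andreadakis hk, funext fun i => leadingTerm_injective _ ?_⟩
  rw [leadingTerm_johnson_conj hc hk]
  refine smul_right_injective _ hm ?_
  change m • _ = m • _
  rw [h1, h3, smul_sub, smul_mul_assoc, mul_smul_comm]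

end Andreadakis

/-! ### Detecting conjugacy by traces of `2 × 2` matrices over `ℤ[X]`. -/

section TraceRepresentation

open Polynomial Matrix

/-- A one-parameter family of `2 × 2` matrices over `ℤ[X]` with `M(-a) = M(a)⁻¹`. -/
noncomputable def traceMatrix (a : ℤ) : Matrix (Fin 2) (Fin 2) ℤ[X] :=
  !![1 - C (2 * a) * X + C (2 * a ^ 2) * X ^ 2, C (2 * a) * X ^ 2;
    C (2 * a ^ 3) * X ^ 2, 1 + C (2 * a) * X + C (2 * a ^ 2) * X ^ 2]

/-- The matrix of coefficients of degree `2` of `traceMatrix a`. -/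
def topMatrix (a : ℤ) : Matrix (Fin 2) (Fin 2) ℤ :=
  !![2 * a ^ 2, 2 * a; 2 * a ^ 3, 2 * a ^ 2]

theorem traceMatrix_mul_neg (a : ℤ) : traceMatrix a * traceMatrix (-a) = 1 := by
  ext1 p q
  fin_cases p <;> fin_cases q <;>
    simp [traceMatrix, Matrix.mul_apply, Fin.sum_univ_two] <;> ring

theorem traceMatrix_neg_mul (a : ℤ) : traceMatrix (-a) * traceMatrix a = 1 := by
  simpa using traceMatrix_mul_neg (-a)

theorem natDegree_traceMatrix_le (a : ℤ) (p q : Fin 2) : (traceMatrix a p q).natDegree ≤ 2 := by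
  fin_cases p <;> fin_cases q <;> simp only [traceMatrix] <;> simp <;> compute_degree

theorem coeff_traceMatrix (a : ℤ) (p q : Fin 2) : (traceMatrix a p q).coeff 2 = topMatrix a p q := by
  fin_cases p <;> fin_cases q <;>
    simp [traceMatrix, topMatrix, coeff_one, coeff_C_mul, -map_mul, -map_pow,
      -eq_intCast]

theorem natDegree_coeff_prod_traceMatrix (l : List ℤ) (p q : Fin 2) :
    ((l.map traceMatrix).prod p q).natDegree ≤ 2 * l.length ∧
      ((l.map traceMatrix).prod p q).coeff (2 * l.length) = (l.map topMatrix).prod p q := by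
  induction l generalizing p q with
  | nil =>
    by_cases h : p = q
    · subst h; simp
    · simp [h]
  | cons a l ih =>
    simp only [List.map_cons, List.prod_cons, List.length_cons, Matrix.mul_apply,
      Fin.sum_univ_two]
    rw [show 2 * (l.length + 1) = 2 + 2 * l.length by ring]
    constructor
    · exact natDegree_add_le_of_degree_le
        (natDegree_mul_le_of_le (natDegree_traceMatrix_le _ _ _) (ih _ _).1)
        (natDegree_mul_le_of_le (natDegree_traceMatrix_le _ _ _) (ih _ _).1)
    · rw [coeff_add,
        coeff_mul_add_eq_of_natDegree_le (natDegree_traceMatrix_le _ _ _) (ih _ _).1,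
        coeff_mul_add_eq_of_natDegree_le (natDegree_traceMatrix_le _ _ _) (ih _ _).1,
        coeff_traceMatrix, coeff_traceMatrix, (ih _ _).2, (ih _ _).2]

theorem coeff_trace_prod_traceMatrix (l : List ℤ) :
    (trace (l.map traceMatrix).prod).coeff (2 * l.length) = trace (l.map topMatrix).prod := by
  simp only [trace, diag_apply, Fin.sum_univ_two, coeff_add,
    (natDegree_coeff_prod_traceMatrix l _ _).2]

/-- `topMatrix a` is `2a` times the column `(1, a)` times the row `(a, 1)`, and the row of `a` meets
the column of `b` in `a + b`. So `k` is a product of the `2a` and the consecutive sums. -/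
theorem prod_topMatrix (a : ℤ) (l : List ℤ) (hne : ∀ b ∈ a :: l, b ≠ 0)
    (hl : (a :: l).IsChain fun b c => b + c ≠ 0) :
    ∃ k : ℤ, k ≠ 0 ∧ ((a :: l).map topMatrix).prod =
      k • vecMulVec ![1, a] ![(a :: l).getLast (List.cons_ne_nil a l), 1] := by
  induction l generalizing a with
  | nil =>
    refine ⟨2 * a, by simpa using hne, ?_⟩
    ext p q
    fin_cases p <;> fin_cases q <;> simp [topMatrix] <;> ring
  | cons b l ih =>
    rw [List.isChain_cons_cons] at hl
    obtain ⟨k, hk, h⟩ := ih b (fun c hc => hne c (List.mem_cons_of_mem a hc)) hl.2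
    refine ⟨2 * a * (a + b) * k,
      mul_ne_zero (mul_ne_zero (mul_ne_zero two_ne_zero (hne a List.mem_cons_self)) hl.1) hk, ?_⟩
    rw [List.map_cons, List.prod_cons, h, List.getLast_cons (List.cons_ne_nil b l)]
    ext p q
    fin_cases p <;> fin_cases q <;>
      simp [topMatrix, Matrix.mul_apply, Fin.sum_univ_two] <;> ring

/-- Taking the trace closes the cycle and adds the factor last plus first. -/
theorem trace_prod_topMatrix_ne_zero {l : List ℤ} (h0 : l ≠ []) (hne : ∀ b ∈ l, b ≠ 0)
    (hl : l.IsChain fun b c => b + c ≠ 0) (hcyc : ∀ b ∈ l.getLast?, ∀ c ∈ l.head?, b + c ≠ 0) :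
    trace (l.map topMatrix).prod ≠ 0 := by
  cases l with
  | nil => exact absurd rfl h0
  | cons a l =>
    obtain ⟨k, hk, h⟩ := prod_topMatrix a l hne hl
    have h1 := hcyc ((a :: l).getLast (List.cons_ne_nil a l))
      (List.getLast?_eq_getLast_of_ne_nil (List.cons_ne_nil a l)) a rfl
    rw [h, trace_smul, trace_vecMulVec]
    simpa [hk] using h1

variable {n : ℕ}

/-- The unit given by `traceMatrix a`. -/
noncomputable def traceUnit (a : ℤ) : (Matrix (Fin 2) (Fin 2) ℤ[X])ˣ :=
  ⟨traceMatrix a, traceMatrix (-a), traceMatrix_mul_neg a, traceMatrix_neg_mul a⟩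

/-- A faithful representation of the free group by `2 × 2` matrices over `ℤ[X]`. -/
noncomputable def traceRep (n : ℕ) : FreeGroup (Fin n) →* (Matrix (Fin 2) (Fin 2) ℤ[X])ˣ :=
  FreeGroup.lift fun i => traceUnit ((i : ℤ) + 1)

/-- The parameter of a letter and its inverse. -/
def letterValue (s : Fin n × Bool) : ℤ := cond s.2 ((s.1 : ℤ) + 1) (-((s.1 : ℤ) + 1))

theorem traceRep_mk (L : List (Fin n × Bool)) :
    (traceRep n (FreeGroup.mk L) : Matrix (Fin 2) (Fin 2) ℤ[X]) =
      ((L.map letterValue).map traceMatrix).prod := by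
  rw [traceRep, FreeGroup.lift_mk, ← Units.coeHom_apply, map_list_prod, List.map_map, List.map_map]
  congr 1
  refine List.map_congr_left fun s _ => ?_
  obtain ⟨i, b⟩ := s
  cases b <;> rfl

theorem letterValue_ne_zero (s : Fin n × Bool) : letterValue s ≠ 0 := by
  obtain ⟨i, b⟩ := s
  cases b <;> simp only [letterValue, cond_true, cond_false] <;> omega

/-- The parameters `i + 1` are positive and distinct, so only a letter and its inverse have opposite
values. -/
theorem letterValue_add_ne_zero {s r : Fin n × Bool} (h : s.1 = r.1 → s.2 = r.2) :
    letterValue s + letterValue r ≠ 0 := by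
  obtain ⟨i, b⟩ := s
  obtain ⟨j, c⟩ := r
  by_cases hij : i = j
  · subst hij
    obtain rfl : b = c := h rfl
    cases b <;> simp only [letterValue, cond_true, cond_false] <;> omega
  · have : (i : ℕ) ≠ j := fun h => hij (Fin.ext h)
    cases b <;> cases c <;> simp only [letterValue, cond_true, cond_false] <;> omega

theorem coeff_trace_traceRep_ne_zero {L : List (Fin n × Bool)} (h0 : L ≠ [])
    (hL : FreeGroup.IsCyclicallyReduced L) :
    (trace (traceRep n (FreeGroup.mk L)).val).coeff (2 * L.length) ≠ 0 := by
  have h := coeff_trace_prod_traceMatrix (L.map letterValue)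
  rw [List.length_map] at h
  rw [traceRep_mk, h]
  refine trace_prod_topMatrix_ne_zero (by simpa using h0) ?_ ?_ ?_
  · intro b hb
    obtain ⟨s, -, rfl⟩ := List.mem_map.1 hb
    exact letterValue_ne_zero s
  · rw [List.isChain_map]
    exact hL.1.imp fun _ _ => letterValue_add_ne_zero
  · intro b hb c hc
    rw [List.getLast?_map, Option.mem_map] at hb
    rw [List.head?_map, Option.mem_map] at hc
    obtain ⟨s, hs, rfl⟩ := hb
    obtain ⟨r, hr, rfl⟩ := hc
    exact letterValue_add_ne_zero (hL.2 s hs r hr)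

/-- Every `traceMatrix a` becomes the identity at `X = 0`. -/
theorem exists_traceRep_eq (g : FreeGroup (Fin n)) : ∃ y,
    (traceRep n g : Matrix (Fin 2) (Fin 2) ℤ[X]) = 1 + Matrix.scalar (Fin 2) X * y := by
  have h : (Units.map (RingHom.mapMatrix (evalRingHom (0 : ℤ))).toMonoidHom).comp (traceRep n) =
      1 := by
    ext i p q
    fin_cases p <;> fin_cases q <;> simp [traceRep, traceUnit, traceMatrix]
  have hg : (traceRep n g).val.map (eval (0 : ℤ)) = 1 :=
    congrArg Units.val (DFunLike.congr_fun h g)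
  have hd : ∀ p q, X ∣ ((traceRep n g).val - 1) p q := fun p q => by
    rw [X_dvd_iff, coeff_zero_eq_eval_zero]
    have := congrFun (congrFun hg p) q
    rw [Matrix.map_apply] at this
    rw [Matrix.sub_apply, eval_sub, this, Matrix.one_apply, Matrix.one_apply]
    split_ifs <;> simp
  choose y hy using hd
  refine ⟨Matrix.of y, ?_⟩
  rw [← sub_eq_iff_eq_add']
  ext1 p q
  rw [hy, Matrix.scalar_apply, Matrix.diagonal_mul, Matrix.of_apply]

/-- `γ_c` is congruent to 1 modulo `X ^ c` and conjugation preserves traces, so the difference of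
traces is divisible by every power of `X`. -/
theorem trace_traceRep_eq {u v : FreeGroup (Fin n)}
    (h : ∀ c, ∃ w, u * (w * v * w⁻¹)⁻¹ ∈ gamma (FreeGroup (Fin n)) c) :
    trace (traceRep n u).val = trace (traceRep n v).val := by
  have hdvd : ∀ c, X ^ c ∣ trace (traceRep n u).val - trace (traceRep n v).val := by
    intro c
    obtain ⟨w, hw⟩ := h c
    obtain ⟨y, hy⟩ := exists_eq_one_add_pow_mul (t := Matrix.scalar (Fin 2) (X : ℤ[X]))
      (fun a => Matrix.scalar_commute X (fun r => Commute.all _ _) a) (traceRep n)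
      exists_traceRep_eq hw
    have hu : traceRep n u = traceRep n (u * (w * v * w⁻¹)⁻¹) * traceRep n (w * v * w⁻¹) := by
      rw [← map_mul, inv_mul_cancel_right]
    have hv : trace (traceRep n (w * v * w⁻¹)).val = trace (traceRep n v).val := by
      rw [map_mul, map_mul, map_inv, Units.val_mul, Units.val_mul, Matrix.trace_mul_comm,
        Units.inv_mul_cancel_left]
    refine ⟨trace (y * (traceRep n (w * v * w⁻¹)).val), ?_⟩
    rw [hu, Units.val_mul, hy, add_mul, one_mul, trace_add, hv, add_sub_cancel_left, ← map_pow,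
      mul_assoc, Matrix.scalar_apply, ← Matrix.smul_eq_diagonal_mul, trace_smul, smul_eq_mul]
  rw [← sub_eq_zero]
  ext c
  rw [coeff_zero]
  exact X_pow_dvd_iff.1 (hdvd (c + 1)) c (Nat.lt_succ_self c)

theorem exists_isCyclicallyReduced {α : Type*} [DecidableEq α] (u : FreeGroup α) :
    ∃ L : List (α × Bool), FreeGroup.IsCyclicallyReduced L ∧ ∃ w, u = w * FreeGroup.mk L * w⁻¹ := by
  refine ⟨FreeGroup.reduceCyclically u.toWord,
    FreeGroup.reduceCyclically.isCyclicallyReduced FreeGroup.isReduced_toWord,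
    FreeGroup.mk (FreeGroup.reduceCyclically.conjugator u.toWord), ?_⟩
  rw [FreeGroup.inv_mk, FreeGroup.mul_mk, FreeGroup.mul_mk,
    FreeGroup.reduceCyclically.conj_conjugator_reduceCyclically, FreeGroup.mk_toWord]

/-- The trace would be the constant 2, whereas a non-empty cyclically reduced word has a non-zero
coefficient in degree twice its length. -/
theorem eq_one_of_forall_mem_gamma {u : FreeGroup (Fin n)}
    (h : ∀ c, u ∈ gamma (FreeGroup (Fin n)) c) : u = 1 := by
  obtain ⟨L, hL, w, rfl⟩ := exists_isCyclicallyReduced u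
  have ht : trace (traceRep n (FreeGroup.mk L)).val = trace (traceRep n 1).val := by
    refine trace_traceRep_eq fun c => ⟨1, ?_⟩
    have := (inferInstance : (gamma (FreeGroup (Fin n)) c).Normal).conj_mem _ (h c) w⁻¹
    simpa [mul_assoc] using this
  rcases eq_or_ne L [] with rfl | h0
  · rw [← FreeGroup.one_eq_mk, mul_one, mul_inv_cancel]
  · have h1 := coeff_trace_traceRep_ne_zero h0 hL
    rw [ht, map_one, Units.val_one, trace_one] at h1
    have hpos := List.length_pos_iff.2 h0
    refine absurd ?_ h1
    rw [Fintype.card_fin, coeff_natCast_ite, if_neg (by omega), Nat.cast_zero]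

theorem magnusCoeff_one_mul {α : Type*} (g h : FreeGroup α) :
    magnusCoeff 1 (g * h) = magnusCoeff 1 g + magnusCoeff 1 h :=
  magnusCoeff_mul one_ne_zero (mem_gamma_one g) (mem_gamma_one h)

/-- An element of a free group that is conjugate to a free generator modulo all terms of the lower
central series is conjugate to it. -/
theorem exists_eq_conj_of {u : FreeGroup (Fin n)} {i : Fin n}
    (h : ∀ c, ∃ w, u * (w * FreeGroup.of i * w⁻¹)⁻¹ ∈ gamma (FreeGroup (Fin n)) c) :
    ∃ w, u = w * FreeGroup.of i * w⁻¹ := by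
  have hu := trace_traceRep_eq h
  obtain ⟨L, hL, w, rfl⟩ := exists_isCyclicallyReduced u
  have hw : trace (traceRep n (w * FreeGroup.mk L * w⁻¹)).val =
      trace (traceRep n (FreeGroup.mk L)).val :=
    trace_traceRep_eq fun c => ⟨w, by rw [mul_inv_cancel]; exact one_mem _⟩
  rw [hw] at hu
  have hi : trace (traceRep n (FreeGroup.of i)).val =
      C 2 + C (4 * ((i : ℤ) + 1) ^ 2) * X ^ 2 := by
    simp [traceRep, traceUnit, traceMatrix, trace]
    ring
  have hi2 : (4 * ((i : ℤ) + 1) ^ 2 : ℤ) ≠ 0 := by positivity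
  -- The trace of a generator has degree 2, and the degree is twice the cyclically reduced length.
  have hlen : L.length = 1 := by
    rcases eq_or_ne L [] with rfl | h0
    · rw [← FreeGroup.one_eq_mk, map_one, Units.val_one, trace_one, hi] at hu
      have := congrArg (coeff · 2) hu
      simp only [Fintype.card_fin, coeff_natCast_ite, coeff_add, coeff_C, coeff_C_mul,
        coeff_X_pow] at this
      exact absurd (by simpa using this.symm) hi2
    · have h1 := coeff_trace_traceRep_ne_zero h0 hL
      have hpos := List.length_pos_iff.2 h0
      rw [hu, hi] at h1
      by_contra hne
      refine h1 ?_
      rw [coeff_add, coeff_C, if_neg (by omega), coeff_C_mul, coeff_X_pow, if_neg (by omega)]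
      simp
  obtain ⟨⟨j, b⟩, rfl⟩ := List.length_eq_one_iff.1 hlen
  have hj : j = i := by
    have hj1 : trace (traceRep n (FreeGroup.mk [(j, b)])).val =
        C 2 + C (4 * ((j : ℤ) + 1) ^ 2) * X ^ 2 := by
      rw [traceRep_mk]
      cases b <;> simp [letterValue, traceMatrix, trace] <;> ring
    rw [hj1, hi] at hu
    have := congrArg (coeff · 2) hu
    simp only [coeff_add, coeff_C, coeff_C_mul, coeff_X_pow] at this
    have h2 : ((j : ℤ) + 1) ^ 2 = ((i : ℤ) + 1) ^ 2 := by simpa using this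
    have h3 : (j : ℤ) + 1 = (i : ℤ) + 1 :=
      (pow_left_inj₀ (by positivity) (by positivity) two_ne_zero).1 h2
    exact Fin.ext (by omega)
  subst hj
  cases b with
  | true => exact ⟨w, rfl⟩
  | false =>
    -- The trace does not separate a generator from its inverse; the linear term of the Magnus
    -- expansion does.
    exfalso
    obtain ⟨w', hw'⟩ := h 2
    have h1 : FreeGroup.mk [(j, false)] = (FreeGroup.of j)⁻¹ := rfl
    have h2 := magnusCoeff_eq_zero one_ne_zero hw'
    have hinv : ∀ g : FreeGroup (Fin n), magnusCoeff 1 g⁻¹ = -magnusCoeff 1 g := fun g => by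
      rw [eq_neg_iff_add_eq_zero, ← magnusCoeff_one_mul, inv_mul_cancel]
      exact magnusCoeff_eq_zero one_ne_zero (one_mem _)
    simp only [h1, magnusCoeff_one_mul, hinv, magnusCoeff_one_of] at h2
    have h3 := congrArg (fun P => P.coeff (FreeMonoid.of j)) h2
    simp [ncVar] at h3

end TraceRepresentation

/-! ### The centralizer of a generator modulo the lower central series. -/

section Centralizer

variable {α : Type*}

/-- A polynomial commuting with the variable `i` has no words containing another letter. -/
theorem coeff_eq_zero_of_commute_ncVar {P : NCPoly α} {i : α}
    (h : P * ncVar i = ncVar i * P) (r : ℕ) {j : α} (hij : i ≠ j) (u : FreeMonoid α) :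
    P.coeff (FreeMonoid.of i ^ r * (FreeMonoid.of j * u)) = 0 := by
  induction r generalizing u with
  | zero =>
    rw [pow_zero, one_mul, ← coeff_mul_ncVar, h, mul_assoc, coeff_ncVar_mul_of_ne _ _ hij]
  | succ r ih =>
    rw [← coeff_mul_ncVar P _ i, h, pow_succ', mul_assoc, mul_assoc, coeff_ncVar_mul, mul_assoc, ih]

theorem eq_pow_or_eq_pow_mul (i : α) (w : FreeMonoid α) :
    (∃ r, w = FreeMonoid.of i ^ r) ∨
      ∃ (r : ℕ) (j : α) (u : FreeMonoid α), i ≠ j ∧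
        w = FreeMonoid.of i ^ r * (FreeMonoid.of j * u) := by
  induction w using FreeMonoid.inductionOn' with
  | one => exact Or.inl ⟨0, rfl⟩
  | of_mul j w ih =>
    by_cases hij : i = j
    · subst hij
      rcases ih with ⟨r, rfl⟩ | ⟨r, k, u, hk, rfl⟩
      · exact Or.inl ⟨r + 1, (pow_succ' _ _).symm⟩
      · exact Or.inr ⟨r + 1, k, u, hk, by rw [pow_succ', mul_assoc]⟩
    · exact Or.inr ⟨0, j, w, hij, by rw [pow_zero, one_mul]⟩

theorem length_of_pow (i : α) (r : ℕ) : (FreeMonoid.of i ^ r).toList.length = r := by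
  induction r with
  | zero => rfl
  | succ r ih => rw [pow_succ, FreeMonoid.toList_mul, List.length_append, ih]; rfl

/-- The evaluation sending the variable `i` to `1` and all the others to `0`. -/
noncomputable def evalVar [DecidableEq α] (i : α) : NCPoly α →ₐ[ℤ] ℤ :=
  MonoidAlgebra.lift ℤ ℤ (FreeMonoid α) (FreeMonoid.lift fun j => if j = i then 1 else 0)

/-- The target of `evalVar` is commutative, so commutators die. This excludes non-zero multiples of
`X_i ^ k`, `k ≥ 2`, as leading terms. -/
theorem evalVar_magnusCoeff [DecidableEq α] (i : α) {k : ℕ} {g : FreeGroup α}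
    (hg : g ∈ gamma (FreeGroup α) (k + 2)) : evalVar i (magnusCoeff (k + 2) g) = 0 := by
  have hg' := hg
  rw [gamma_succ _ (k + 1) (by omega)] at hg'
  have hle := (gamma_succ (FreeGroup α) (k + 1) (by omega)).ge
  refine Subgroup.closure_induction (p := fun g _ => evalVar i (magnusCoeff (k + 2) g) = 0)
    ?_ ?_ ?_ ?_ hg'
  · rintro _ ⟨a, ha, b, -, rfl⟩
    change evalVar i (magnusCoeff (k + 1 + 1) _) = 0
    rw [magnusCoeff_commutator (by omega) one_ne_zero ha (mem_gamma_one b), map_sub, map_mul,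
      map_mul, mul_comm, sub_self]
  · rw [magnusCoeff_eq_zero (by omega) (one_mem _), map_zero]
  · intro a b ha hb h1 h2
    rw [magnusCoeff_mul (by omega) (hle ha) (hle hb), map_add, h1, h2, add_zero]
  · intro a ha h1
    have := magnusCoeff_mul (by omega) (hle ha) (inv_mem (hle ha))
    rw [mul_inv_cancel, magnusCoeff_eq_zero (by omega) (one_mem _)] at this
    have h2 := congrArg (evalVar i) this
    rwa [map_add, h1, zero_add, map_zero, eq_comm] at h2

theorem evalVar_single_pow [DecidableEq α] (i : α) (r : ℕ) (b : ℤ) :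
    evalVar i (MonoidAlgebra.single (FreeMonoid.of i ^ r) b) = b := by
  simp [evalVar]

theorem magnusCoeff_zpow {k : ℕ} (hk : k ≠ 0) {g : FreeGroup α}
    (hg : g ∈ gamma (FreeGroup α) k) (b : ℤ) : magnusCoeff k (g ^ b) = b • magnusCoeff k g := by
  obtain ⟨k, rfl⟩ := Nat.exists_eq_succ_of_ne_zero hk
  exact map_zsmul (leadingTerm α k)
    b (Additive.ofMul (QuotientGroup.mk ⟨g, hg⟩ : GammaQuotient (FreeGroup α) (k + 1)))

/-- The quadratic term of the commutator is `b (X_i X_j - X_j X_i)`. -/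
theorem eq_zero_of_commutator_zpow_mem {i j : α} (hij : i ≠ j) {b : ℤ}
    (h : ⁅FreeGroup.of i ^ b, FreeGroup.of j⁆ ∈ gamma (FreeGroup α) 3) : b = 0 := by
  have h1 := magnusCoeff_eq_zero two_ne_zero h
  rw [magnusCoeff_commutator_of one_ne_zero (mem_gamma_one _),
    magnusCoeff_zpow one_ne_zero (mem_gamma_one _), magnusCoeff_one_of] at h1
  have h2 := congrArg (fun P => P.coeff (FreeMonoid.of i * FreeMonoid.of j)) h1
  simp only [MonoidAlgebra.coeff_sub, Finsupp.sub_apply, coeff_mul_ncVar,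
    coeff_ncVar_mul_of_ne _ _ hij.symm, MonoidAlgebra.coeff_smul_apply] at h2
  simpa [ncVar] using h2

variable [LinearOrder α] [Finite α]

/-- The centralizer of a free generator in the quotient of a free group by a term of the lower
central series. -/
theorem exists_zpow_mul_mem_gamma {c : ℕ} {g : FreeGroup α} {i : α}
    (h : ⁅g, FreeGroup.of i⁆ ∈ gamma (FreeGroup α) (c + 1)) :
    ∃ a : ℤ, FreeGroup.of i ^ a * g ∈ gamma (FreeGroup α) c := by
  suffices H : ∀ k ≤ c, ∃ a : ℤ, FreeGroup.of i ^ a * g ∈ gamma (FreeGroup α) k from H c le_rfl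
  intro k
  induction k with
  | zero => exact fun _ => ⟨0, Subgroup.mem_top _⟩
  | succ k ih =>
    intro hk
    rcases eq_or_ne k 0 with rfl | hk0
    · exact ⟨0, mem_gamma_one _⟩
    obtain ⟨a, ha⟩ := ih (by omega)
    set g' := FreeGroup.of i ^ a * g with hg'
    have hcomm : ⁅g', FreeGroup.of i⁆ ∈ gamma (FreeGroup α) (k + 1 + 1) := by
      have h1 : ⁅g', FreeGroup.of i⁆ =
          FreeGroup.of i ^ a * ⁅g, FreeGroup.of i⁆ * (FreeGroup.of i ^ a)⁻¹ := by
        rw [hg', commutatorElement_mul_left_eq_conj_mul,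
          ((Commute.refl (FreeGroup.of i)).zpow_left a).commutator_eq, mul_one]
      rw [h1]
      exact Subgroup.Normal.conj_mem inferInstance _ (gamma_antitone (by omega) h) _
    set P := magnusCoeff k g'
    have hPc : P * ncVar i = ncVar i * P := by
      rw [← sub_eq_zero, ← magnusCoeff_commutator_of hk0 ha]
      exact magnusCoeff_eq_zero k.succ_ne_zero hcomm
    -- `P` is homogeneous of degree `k` and commutes with `X_i`, so only the word `i ^ k` survives.
    have hPs : P = MonoidAlgebra.single (FreeMonoid.of i ^ k) (P.coeff (FreeMonoid.of i ^ k)) := by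
      ext w
      by_cases hw : w = FreeMonoid.of i ^ k
      · subst hw
        simp
      · rw [MonoidAlgebra.coeff_single, Finsupp.single_eq_of_ne hw]
        rcases eq_pow_or_eq_pow_mul i w with ⟨r, rfl⟩ | ⟨r, j, u, hij, rfl⟩
        · by_contra hne
          have := length_of_coeff_magnusCoeff_ne_zero hk0 ha hne
          rw [length_of_pow] at this
          exact hw (by rw [this])
        · exact coeff_eq_zero_of_commute_ncVar hPc r hij u
    set b := P.coeff (FreeMonoid.of i ^ k)
    -- For `k = 1` the term `b X_i` is removed by the factor `x_i ^ (-b)`; for `k ≥ 2` it is already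
    -- zero by `evalVar`.
    rcases Nat.exists_eq_succ_of_ne_zero hk0 with ⟨_ | l, rfl⟩
    · refine ⟨-b + a, ?_⟩
      rw [zpow_add, mul_assoc, ← hg']
      refine mem_gamma_succ_of_magnusCoeff_eq_zero one_ne_zero (mem_gamma_one _) ?_
      rw [magnusCoeff_one_mul, magnusCoeff_zpow one_ne_zero (mem_gamma_one _), magnusCoeff_one_of]
      change -b • ncVar i + P = 0
      rw [hPs, ncVar, show FreeMonoid.of i ^ Nat.succ 0 = FreeMonoid.of i from pow_one _,
        MonoidAlgebra.smul_single, ← MonoidAlgebra.single_add]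
      simp
    · refine ⟨a, mem_gamma_succ_of_magnusCoeff_eq_zero hk0 ha ?_⟩
      have h1 := evalVar_magnusCoeff i ha
      rw [show magnusCoeff (l + 2) g' = P from rfl, hPs, evalVar_single_pow] at h1
      change P = 0
      rw [hPs, h1, MonoidAlgebra.single_zero]

end Centralizer

/-! ### The induced filtration of the outer automorphism group. -/

section OutFiltration

variable {n : ℕ}

theorem mk_mem_outAndreadakis_iff {c : ℕ} {φ : MulAut (FreeGroup (Fin n))} :
    (QuotientGroup.mk φ : Out (FreeGroup (Fin n))) ∈ outAndreadakis n c ↔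
      ∃ w, MulAut.conj w * φ ∈ andreadakis n c := by
  constructor
  · rintro ⟨ψ, hψ, he⟩
    obtain ⟨w, hw⟩ := QuotientGroup.eq_iff_div_mem.1 he
    refine ⟨w, ?_⟩
    rw [hw, div_mul_cancel]
    exact hψ
  · rintro ⟨w, hw⟩
    refine ⟨_, hw, ?_⟩
    refine QuotientGroup.eq_iff_div_mem.2 ⟨w, ?_⟩
    rw [mul_div_cancel_right]

theorem outAndreadakis_antitone (n : ℕ) : Antitone (outAndreadakis n) := fun _ _ h =>
  Subgroup.map_mono (andreadakis_antitone n h)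

theorem mk_mul_conj_eq (w : FreeGroup (Fin n)) (φ : MulAut (FreeGroup (Fin n))) :
    (QuotientGroup.mk (MulAut.conj w * φ) : Out (FreeGroup (Fin n))) = QuotientGroup.mk φ :=
  QuotientGroup.eq_iff_div_mem.2 ⟨w, by rw [mul_div_cancel_right]⟩

theorem eq_one_of_forall_mem_andreadakis {φ : MulAut (FreeGroup (Fin n))}
    (h : ∀ c, φ ∈ andreadakis n c) : φ = 1 := by
  ext g
  rw [MulAut.one_apply, ← mul_inv_eq_one]
  exact eq_one_of_forall_mem_gamma fun c =>
    gamma_antitone (Nat.le_succ c) (mem_andreadakis_iff.1 (h c) g)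

/-- A free group of rank at most 1 is abelian, so `γ_2` is trivial. -/
theorem andreadakis_one_eq_bot [Subsingleton (Fin n)] : andreadakis n 1 = ⊥ := by
  have hcomm : IsMulCommutative (⊤ : Subgroup (FreeGroup (Fin n))) := by
    rw [← FreeGroup.closure_range_of]
    refine Subgroup.isMulCommutative_closure ?_
    rintro _ ⟨i, rfl⟩ _ ⟨j, rfl⟩
    rw [Subsingleton.elim i j]
  rw [eq_bot_iff]
  intro φ hφ
  rw [mem_andreadakis_iff, gamma_succ _ 1 le_rfl, gamma_one,
    Subgroup.commutator_self_eq_bot_iff.2 hcomm] at hφ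
  rw [Subgroup.mem_bot]
  ext g
  exact mul_inv_eq_one.1 (Subgroup.mem_bot.1 (hφ g))

/-- The filtration of the outer automorphism group is separated. -/
theorem eq_one_of_forall_mem_outAndreadakis {x : Out (FreeGroup (Fin n))}
    (h : ∀ c, x ∈ outAndreadakis n (c + 1)) : x = 1 := by
  rcases subsingleton_or_nontrivial (Fin n) with hn | hn
  · have h0 := h 0
    rw [outAndreadakis, zero_add, andreadakis_one_eq_bot, Subgroup.map_bot] at h0
    exact h0
  obtain ⟨φ₀, rfl⟩ := QuotientGroup.mk_surjective x
  obtain ⟨i, j, hij⟩ := exists_pair_ne (Fin n)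
  obtain ⟨w₀, hw₀⟩ : ∃ w, φ₀ (FreeGroup.of i) = w * FreeGroup.of i * w⁻¹ := by
    refine exists_eq_conj_of fun c => ?_
    obtain ⟨w, hw⟩ := mk_mem_outAndreadakis_iff.1 (h c)
    have h1 := mem_andreadakis_iff.1 hw (FreeGroup.of i)
    have h2 := Subgroup.Normal.conj_mem inferInstance _ h1 w⁻¹
    refine ⟨w⁻¹, gamma_antitone (by omega : c ≤ c + 1 + 1) ?_⟩
    convert h2 using 1
    simp [mul_assoc]
  set φ := MulAut.conj w₀⁻¹ * φ₀ with hφdef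
  have hmk : (QuotientGroup.mk φ₀ : Out (FreeGroup (Fin n))) = QuotientGroup.mk φ :=
    (mk_mul_conj_eq _ _).symm
  rw [hmk] at h ⊢
  have hφ : φ (FreeGroup.of i) = FreeGroup.of i := by
    simp [hφdef, hw₀, mul_assoc]
  -- As `φ` fixes `x_i`, a correcting `w` centralizes `x_i` modulo `γ_{c+2}`, so it may be replaced
  -- by a power of `x_i`.
  have hstep : ∀ c, ∃ a : ℤ, MulAut.conj (FreeGroup.of i ^ a) * φ ∈ andreadakis n (c + 1) := by
    intro c
    obtain ⟨w, hw⟩ := mk_mem_outAndreadakis_iff.1 (h c)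
    have h1 := mem_andreadakis_iff.1 hw (FreeGroup.of i)
    rw [MulAut.mul_apply, hφ] at h1
    obtain ⟨a, ha⟩ := exists_zpow_mul_mem_gamma (c := c + 1) (g := w⁻¹) (i := i) (by
      have h2 := Subgroup.Normal.conj_mem inferInstance _ (inv_mem h1) w⁻¹
      convert h2 using 1
      simp [commutatorElement_def, mul_assoc])
    refine ⟨a, ?_⟩
    have h3 := mul_mem (conj_mem_andreadakis ha) hw
    rwa [← mul_assoc, ← map_mul, inv_mul_cancel_right] at h3
  choose a ha using hstep
  -- The comparison is made modulo `γ_3`, where the commutator with `x_j` detects the exponent; `a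
  -- 0`, known only for `G_1`, is not controlled.
  have hconst : ∀ c, a (c + 1) = a 1 := by
    intro c
    have h1 := andreadakis_antitone n (by omega : 2 ≤ c + 1 + 1) (ha (c + 1))
    have h2 := mul_mem h1 (inv_mem (ha 1))
    have h3 : MulAut.conj (FreeGroup.of i ^ a (c + 1)) * φ *
        (MulAut.conj (FreeGroup.of i ^ a 1) * φ)⁻¹ =
        MulAut.conj (FreeGroup.of i ^ (a (c + 1) - a 1)) := by
      rw [zpow_sub, map_mul, map_inv]
      group
    rw [h3] at h2
    exact sub_eq_zero.1 (eq_zero_of_commutator_zpow_mem hij (conj_mem_andreadakis_iff.1 h2 j))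
  have hone : MulAut.conj (FreeGroup.of i ^ a 1) * φ = 1 := by
    refine eq_one_of_forall_mem_andreadakis fun c => ?_
    refine andreadakis_antitone n (by omega : c ≤ c + 1 + 1) ?_
    rw [← hconst c]
    exact ha (c + 1)
  rw [← mk_mul_conj_eq (FreeGroup.of i ^ a 1), hone]
  rfl

theorem andreadakis_one_eq_ker (n : ℕ) : andreadakis n 1 = (autToGL n).ker := by
  ext φ
  have h1 : φ ∈ (autToGL n).ker ↔ autToGLH1 (FreeGroup (Fin n)) φ = 1 := by
    rw [MonoidHom.mem_ker, autToGL, MonoidHom.comp_apply]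
    exact (Matrix.GeneralLinearGroup.toLin' (basisH1 n)).symm.map_eq_one_iff
  have h2 : gamma (FreeGroup (Fin n)) (1 + 1) = commutator (FreeGroup (Fin n)) :=
    Subgroup.top_lowerCentralSeries_one
  have h3 : ∀ g, φ g * g⁻¹ ∈ commutator (FreeGroup (Fin n)) ↔
      Abelianization.of (φ g) = Abelianization.of g := fun g => by
    rw [← Abelianization.ker_of, MonoidHom.mem_ker, map_mul, map_inv, mul_inv_eq_one]
  rw [h1, mem_andreadakis_iff, h2]
  simp only [h3]
  constructor
  · intro h
    ext x
    obtain ⟨y, hy⟩ := QuotientGroup.mk_surjective x.toMul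
    obtain rfl : x = Additive.ofMul (Abelianization.of y) := congrArg Additive.ofMul hy.symm
    rw [autToGLH1_apply, h]
    rfl
  · intro h g
    have := autToGLH1_apply φ g
    rw [h] at this
    exact congrArg Additive.toMul this.symm

theorem outAndreadakis_one (n : ℕ) : outAndreadakis n 1 = torelli n := by
  rw [torelli, outToGL, QuotientGroup.ker_lift, outAndreadakis, andreadakis_one_eq_ker]

theorem exists_mulEquiv_of_injective {Q M : Type*} [Group Q] [AddCommGroup M] [Module.Finite ℤ M]
    [Module.IsTorsionFree ℤ M] (f : Q →* Multiplicative M) (hf : Function.Injective f) :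
    ∃ r : ℕ, Nonempty (Q ≃* Multiplicative (Fin r → ℤ)) := by
  let N : Submodule ℤ M := AddSubgroup.toIntSubmodule (Subgroup.toAddSubgroup' f.range)
  have : Module.Free ℤ N := inferInstance
  let e : Q ≃* f.range := MonoidHom.ofInjective hf
  let e' : f.range ≃* Multiplicative N := MulEquiv.mk' (Equiv.refl _) fun _ _ => rfl
  exact ⟨Module.finrank ℤ N, ⟨(e.trans e').trans
    (AddEquiv.toMultiplicative (Module.finBasis ℤ N).equivFun.toAddEquiv)⟩⟩

instance isTorsionFree_gammaQuotient {α : Type*} [LinearOrder α] [Finite α] (k : ℕ) :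
    Module.IsTorsionFree ℤ (Additive (GammaQuotient (FreeGroup α) (k + 1))) :=
  Function.Injective.moduleIsTorsionFree (leadingTerm α k) (leadingTerm_injective k)
    fun m x => map_zsmul _ m x

theorem isTorsionFree_quotient_innerJohnson [Nontrivial (Fin n)] {c : ℕ} (hc : 1 ≤ c) :
    Module.IsTorsionFree ℤ
      ((Fin n → Additive (GammaQuotient (FreeGroup (Fin n)) (c + 1))) ⧸ innerJohnson n c hc) := by
  refine Module.IsTorsionFree.of_smul_eq_zero fun m x hmx => ?_
  obtain ⟨v, rfl⟩ := QuotientAddGroup.mk_surjective x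
  by_cases hm : m = 0
  · exact Or.inl hm
  · right
    rw [QuotientAddGroup.eq_zero_iff]
    refine mem_innerJohnson_of_smul_mem hc hm ?_
    rwa [← QuotientAddGroup.eq_zero_iff, QuotientAddGroup.mk_zsmul]

/-- The Johnson homomorphism modulo inner automorphisms. -/
noncomputable def outerJohnson (n c : ℕ) (hc : 1 ≤ c) : andreadakis n c →* Multiplicative
    ((Fin n → Additive (GammaQuotient (FreeGroup (Fin n)) (c + 1))) ⧸ innerJohnson n c hc) :=
  (AddMonoidHom.toMultiplicative (QuotientAddGroup.mk' (innerJohnson n c hc))).comp (johnson n c hc)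

theorem mem_ker_outerJohnson_iff {c : ℕ} (hc : 1 ≤ c) (φ : andreadakis n c) :
    φ ∈ (outerJohnson n c hc).ker ↔
      (QuotientGroup.mk φ.1 : Out (FreeGroup (Fin n))) ∈ outAndreadakis n (c + 1) := by
  have h1 : φ ∈ (outerJohnson n c hc).ker ↔ (johnson n c hc φ).toAdd ∈ innerJohnson n c hc :=
    QuotientAddGroup.eq_zero_iff _
  rw [h1, mem_innerJohnson_iff, mk_mem_outAndreadakis_iff]
  constructor
  · rintro ⟨g, hg, he⟩
    refine ⟨g⁻¹, ?_⟩
    have h2 : johnson n c hc (⟨MulAut.conj g, hg⟩⁻¹ * φ) = 1 := by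
      rw [map_mul, map_inv, inv_mul_eq_one]
      exact he
    rw [johnson_eq_one_iff] at h2
    rw [map_inv]
    exact h2
  · rintro ⟨w, hw⟩
    have hw' : MulAut.conj w⁻¹ ∈ andreadakis n c := by
      rw [map_inv, inv_mem_iff, ← mul_mem_cancel_right φ.2]
      exact andreadakis_antitone n (Nat.le_succ c) hw
    refine ⟨w⁻¹, hw', ?_⟩
    have h2 : johnson n c hc (⟨MulAut.conj w⁻¹, hw'⟩⁻¹ * φ) = 1 := by
      rw [johnson_eq_one_iff]
      convert hw using 1
      simp
    rw [map_mul, map_inv, inv_mul_eq_one] at h2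
    exact congrArg Multiplicative.toAdd h2

theorem exists_injective_of_ker_eq {G Q M : Type*} [Group G] [Group Q] [Group M] {p : G →* Q}
    (hp : Function.Surjective p) {q : G →* M} (h : p.ker = q.ker) :
    ∃ f : Q →* M, Function.Injective f := by
  let e := (QuotientGroup.quotientKerEquivOfSurjective p hp).symm.trans
    (QuotientGroup.quotientMulEquivOfEq h)
  exact ⟨(QuotientGroup.kerLift q).comp e.toMonoidHom,
    (QuotientGroup.kerLift_injective q).comp e.injective⟩

/-- The projection from a term of the Andreadakis filtration to the corresponding quotient of
successive terms of the filtration of the outer automorphism group. -/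
def mkOutQuotient (n c : ℕ) : andreadakis n c →* outAndreadakis n c ⧸
    (outAndreadakis n (c + 1)).subgroupOf (outAndreadakis n c) :=
  (QuotientGroup.mk' _).comp ((QuotientGroup.mk' _).subgroupMap (andreadakis n c))

theorem mkOutQuotient_surjective (n c : ℕ) : Function.Surjective (mkOutQuotient n c) :=
  (QuotientGroup.mk'_surjective _).comp (MonoidHom.subgroupMap_surjective _ _)

theorem ker_mkOutQuotient (n c : ℕ) (hc : 1 ≤ c) :
    (mkOutQuotient n c).ker = (outerJohnson n c hc).ker := by
  ext φ
  rw [mem_ker_outerJohnson_iff]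
  exact (QuotientGroup.eq_one_iff _).trans Subgroup.mem_subgroupOf

/-- The successive quotients of the filtration are free abelian of finite rank. -/
theorem exists_mulEquiv_quotient (n : ℕ) {c : ℕ} (hc : 1 ≤ c) : ∃ r : ℕ, Nonempty
    ((outAndreadakis n c ⧸ (outAndreadakis n (c + 1)).subgroupOf (outAndreadakis n c)) ≃*
      Multiplicative (Fin r → ℤ)) := by
  rcases subsingleton_or_nontrivial (Fin n) with hn | hn
  · have h0 : outAndreadakis n c = ⊥ := by
      rw [eq_bot_iff, ← Subgroup.map_bot (QuotientGroup.mk' _), ← andreadakis_one_eq_bot]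
      exact outAndreadakis_antitone n hc
    have : Subsingleton (outAndreadakis n c) := by
      rw [h0]
      infer_instance
    have : Subsingleton (outAndreadakis n c ⧸
        (outAndreadakis n (c + 1)).subgroupOf (outAndreadakis n c)) :=
      (QuotientGroup.mk_surjective).subsingleton
    exact exists_mulEquiv_of_injective (M := ℤ) 1 (Function.injective_of_subsingleton _)
  have := isTorsionFree_quotient_innerJohnson (n := n) hc
  have : Module.Finite ℤ ((Fin n → Additive (GammaQuotient (FreeGroup (Fin n)) (c + 1))) ⧸
      innerJohnson n c hc) :=
    Module.Finite.of_surjective (QuotientAddGroup.mk' (innerJohnson n c hc)).toIntLinearMap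
      (QuotientAddGroup.mk'_surjective _)
  obtain ⟨f, hf⟩ := exists_injective_of_ker_eq (mkOutQuotient_surjective n c)
    (ker_mkOutQuotient n c hc)
  exact exists_mulEquiv_of_injective f hf

/-- The image is `dℤ` with `d ≠ 0`; divide by `d`. -/
theorem exists_surjective_of_ne_one {S : Type*} [Group S] (f : S →* Multiplicative ℤ) (hf : f ≠ 1) :
    ∃ g : S →* Multiplicative ℤ, Function.Surjective g := by
  obtain ⟨d, hd⟩ := Int.subgroup_cyclic (Subgroup.toAddSubgroup' f.range)
  have hmem : ∀ s, ∃ k : ℤ, k * d = (f s).toAdd := fun s => by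
    have : (f s).toAdd ∈ Subgroup.toAddSubgroup' f.range := ⟨s, rfl⟩
    rw [hd, AddSubgroup.mem_closure_singleton] at this
    simpa using this
  have hd0 : d ≠ 0 := by
    rintro rfl
    refine hf (MonoidHom.ext fun s => ?_)
    obtain ⟨k, hk⟩ := hmem s
    rw [mul_zero] at hk
    exact congrArg Multiplicative.ofAdd hk.symm
  choose k hk using hmem
  refine ⟨MonoidHom.mk' (fun s => Multiplicative.ofAdd (k s)) fun a b => ?_, fun y => ?_⟩
  · rw [← ofAdd_add]
    refine congrArg Multiplicative.ofAdd (mul_right_cancel₀ hd0 ?_)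
    rw [add_mul, hk, hk, hk, map_mul, toAdd_mul]
  · have : y.toAdd * d ∈ Subgroup.toAddSubgroup' f.range := by
      rw [hd, AddSubgroup.mem_closure_singleton]
      exact ⟨y.toAdd, by simp⟩
    obtain ⟨s, hs⟩ := this
    refine ⟨s, congrArg Multiplicative.ofAdd (mul_right_cancel₀ hd0 ((hk s).trans ?_))⟩
    exact hs

theorem iInf_outAndreadakis (n : ℕ) : (⨅ c : ℕ, outAndreadakis n (c + 1)) = ⊥ := by
  rw [eq_bot_iff]
  intro x hx
  exact eq_one_of_forall_mem_outAndreadakis (Subgroup.mem_iInf.1 hx)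

/-- Non-trivial subgroups of the Torelli group map onto `ℤ`. -/
theorem exists_surjective_of_le_torelli {S : Subgroup (Out (FreeGroup (Fin n)))}
    (hS : S ≤ torelli n) (hne : S ≠ ⊥) : ∃ f : S →* Multiplicative ℤ, Function.Surjective f := by
  -- Otherwise induction from the Torelli group would put `S` in every term, whose intersection is
  -- trivial.
  obtain ⟨c, hc, hc'⟩ : ∃ c, S ≤ outAndreadakis n (c + 1) ∧ ¬ S ≤ outAndreadakis n (c + 2) := by
    by_contra! h
    refine hne (eq_bot_iff.2 ?_)
    rw [← iInf_outAndreadakis]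
    refine le_iInf fun c => ?_
    induction c with
    | zero => rwa [zero_add, outAndreadakis_one]
    | succ c ih => exact h c ih
  obtain ⟨r, ⟨e⟩⟩ := exists_mulEquiv_quotient n (Nat.succ_pos c)
  obtain ⟨s, hs, hs'⟩ := SetLike.not_le_iff_exists.1 hc'
  let f : S →* Multiplicative (Fin r → ℤ) :=
    (e.toMonoidHom.comp (QuotientGroup.mk' _)).comp (Subgroup.inclusion hc)
  have hf : f ⟨s, hs⟩ ≠ 1 := by
    intro h
    have h1 := (EmbeddingLike.map_eq_one_iff (f := e)).1 h
    exact hs' (Subgroup.mem_subgroupOf.1 ((QuotientGroup.eq_one_iff _).1 h1))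
  obtain ⟨i, hi⟩ : ∃ i, (f ⟨s, hs⟩).toAdd i ≠ 0 := by
    by_contra! h
    exact hf (congrArg Multiplicative.ofAdd (funext h))
  refine exists_surjective_of_ne_one
    ((AddMonoidHom.toMultiplicative (Pi.evalAddMonoidHom (fun _ : Fin r => ℤ) i)).comp f)
    fun h => hi ?_
  exact congrArg Multiplicative.toAdd (DFunLike.congr_fun h ⟨s, hs⟩)

end OutFiltration

end FreeGroupOut

theorem mainTheorem4 (n : ℕ) :
    (∀ S : Subgroup (FreeGroupOut.Out (FreeGroup (Fin n))),
      S ≤ FreeGroupOut.torelli n → S ≠ ⊥ →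
        ∃ f : S →* Multiplicative ℤ, Function.Surjective f) ∧
    FreeGroupOut.outAndreadakis n 1 = FreeGroupOut.torelli n ∧
    (⨅ c : ℕ, FreeGroupOut.outAndreadakis n (c + 1)) = ⊥ ∧
    (∀ c : ℕ, 1 ≤ c →
      FreeGroupOut.outAndreadakis n (c + 1) ≤ FreeGroupOut.outAndreadakis n c ∧
      ∃ r : ℕ, Nonempty
        ((FreeGroupOut.outAndreadakis n c ⧸
            (FreeGroupOut.outAndreadakis n (c + 1)).subgroupOf (FreeGroupOut.outAndreadakis n c))
          ≃* Multiplicative (Fin r → ℤ))) :=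
  ⟨fun _ hS hne => FreeGroupOut.exists_surjective_of_le_torelli hS hne,
    FreeGroupOut.outAndreadakis_one n, FreeGroupOut.iInf_outAndreadakis n, fun c hc =>
      ⟨FreeGroupOut.outAndreadakis_antitone n (Nat.le_succ c),
        FreeGroupOut.exists_mulEquiv_quotient n hc⟩⟩
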